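/- **Conventions.** A bisimplicial set $X$ is a functor $\mathbf{\Delta}^{\mathrm{op}}\times\mathbf{\Delta}^{\mathrm{op}}\to\mathbf{Set}$, with values $X_{n,m}$; its $n$-th column is the simplicial set $X_{n,\bullet}$ and its $m$-th row is $X_{\bullet,m}$. We write $d_{i,\bullet}$, $s_{i,\bullet}$ for the horizontal operators $X_{n,\bullet}\to X_{n-1,\bullet}$, $X_{n,\bullet}\to X_{n+1,\bullet}$. For a simplicial set $A$, let $\mathrm{M}_{\mathrm v}(A,X)$ be the simplicial set with $\mathrm{M}_{\mathrm v}(A,X)_m=\mathrm{Hom}_{\mathbf{sSet}}(A,X_{\bullet,m})$. Let $G^n\subseteq\Delta^n$ be the spine, i.e. the union of the edges $\{i,i+1\}$ for $0\le i<n$. A *Segal space* is a bisimplicial set $X$ such that - $X$ is vertically Reedy fibrant: for every $n\ge 0$ the morphism $X_{n,\bullet}\cong\mathrm{M}_{\mathrm v}(\Delta^n,X)\to\mathrm{M}_{\mathrm v}(\partial\Delta^n,X)$ is a Kan fibration; - $X$ satisfies the Segal condition: for every $n\ge 1$ the morphism $\mathrm{M}_{\mathrm v}(\Delta^n,X)\to\mathrm{M}_{\mathrm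 v}(G^n,X)$ is a weak homotopy equivalence of simplicial sets. The *classifying diagram* of a small category $\mathcal C$ is the bisimplicial set $N(\mathcal C)$ with $N(\mathcal C)_{n,m}=\mathrm{Fun}([n]\times\mathbf I[m],\mathcal C)$ (the set of functors), where $\mathbf I[m]$ is the groupoid obtained by freely inverting all morphisms of $[m]=\{0<\dots<m\}$. This defines a functor $N:\mathbf{Cat}\to\mathbf{ssSet}$ from small categories to bisimplicial sets, which has a left adjoint $\tau_1:\mathbf{ssSet}\to\mathbf{Cat}$. For a Segal space $X$ and $x_0,\dots,x_n\in X_{0,0}$, let $X(x_0,\dots,x_n)$ be the fibre of the morphism $X_{n,\bullet}\to X_{0,\bullet}\times\cdots\times X_{0,\bullet}$ (induced by the $n+1$ vertices of $[n]$) over $(x_0,\dots,x_n)$. The *homotopy category* $\mathrm{Ho}\,X$ has the elements of $X_{0,0}$ as objects, and $\mathrm{Hom}_{\mathrm{Ho}\,X}(x_0,x_1)=\pi_0 X(x_0,x_1)$; the identity of $x$ is the connected component of $s_{0,\bullet}(x)$ in $X(x,x)$; composition is the map $$\pi_0X(x_0,x_1)\times\pi_0X(x_1,x_2)\;\cong\;\pi_0X(x_0,x_1,x_2)\;\xrightarrow{\;\pi_0(d_{1,\bullet})\;}\;\pi_0X(x_0,x_2),$$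 where the bijection on the left is the inverse of the one induced by $(d_{2,\bullet},d_{0,\bullet})$. This is a category. **Proposition.** Let $X$ be a Segal space. For each small category $\mathcal C$ there is a bijection $$\mathrm{Hom}_{\mathbf{ssSet}}(X,N(\mathcal C))\;\cong\;\mathrm{Fun}(\mathrm{Ho}\,X,\mathcal C)$$ between morphisms of bisimplicial sets $X\to N(\mathcal C)$ and functors $\mathrm{Ho}\,X\to\mathcal C$, and it is natural in $\mathcal C$. In particular, $\mathrm{Ho}\,X$ is isomorphic (as a category) to $\tau_1X$. -/

import Mathlib

universe u

open CategoryTheory MonoidalCategory CartesianMonoidalCategory Simplicial HomotopicalAlgebra Opposite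
open SSet SSet.modelCategoryQuillen

namespace SegalSpaces

lemma whiskerLeft_δ_one (X : SSet.{u}) : X ◁ stdSimplex.δ (1 : Fin 2) = fst X Δ[0] ≫ SSet.ι₀ := by
  rw [stdSimplex.δ_one_eq_const]; rfl

lemma whiskerLeft_δ_zero (X : SSet.{u}) : X ◁ stdSimplex.δ (0 : Fin 2) = fst X Δ[0] ≫ SSet.ι₁ := by
  rw [stdSimplex.δ_zero_eq_const]; rfl

lemma fst_Δ0_cancel {X E : SSet.{u}} {f g : X ⟶ E} (h : fst X Δ[0] ≫ f = fst X Δ[0] ≫ g) : f = g := by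
  have : lift (𝟙 X) (SSet.const (stdSimplex.obj₀Equiv.symm 0)) ≫ fst X Δ[0] ≫ f =
    lift (𝟙 X) (SSet.const (stdSimplex.obj₀Equiv.symm 0)) ≫ fst X Δ[0] ≫ g := by rw [h]
  simpa using this

/-- Filling an outer 2-horn of homotopies along a fibration. -/
lemma fillHorn {X E B : SSet.{u}} (p : E ⟶ B) [Fibration p] (a b : X ⊗ Δ[1] ⟶ E)
    (hab : SSet.ι₀ ≫ a = SSet.ι₀ ≫ b) (σ : X ⊗ Δ[2] ⟶ B)
    (ha : a ≫ p = X ◁ stdSimplex.δ 2 ≫ σ) (hb : b ≫ p = X ◁ stdSimplex.δ 1 ≫ σ) :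
    ∃ c : X ⊗ Δ[1] ⟶ E, SSet.ι₀ ≫ c = SSet.ι₁ ≫ a ∧ SSet.ι₁ ≫ c = SSet.ι₁ ≫ b ∧
      c ≫ p = X ◁ stdSimplex.δ 0 ≫ σ := by
  let f : ∀ (j : Fin 3) (_ : j ≠ 0), Δ[1] ⟶ (ihom X).obj E := fun j _ =>
    if j = 1 then MonoidalClosed.curry b else MonoidalClosed.curry a
  have hf : horn.IsCompatible (i := (0 : Fin 3)) f := by
    rw [horn.isCompatible_iff]
    intro j k hj hk hjk
    obtain ⟨rfl, rfl⟩ : j = 1 ∧ k = 2 := by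
      revert j k; decide
    change stdSimplex.δ (1 : Fin 2) ≫ MonoidalClosed.curry b = stdSimplex.δ (1 : Fin 2) ≫ MonoidalClosed.curry a
    rw [← MonoidalClosed.curry_natural_left, ← MonoidalClosed.curry_natural_left,
      whiskerLeft_δ_one, Category.assoc, Category.assoc, hab]
  obtain ⟨φ, h1, h2⟩ := hf.exists_lift ((ihom X).map p) (MonoidalClosed.curry σ) (by
    intro j hj
    have : j = 1 ∨ j = 2 := by revert j; decide
    rcases this with rfl | rfl
    · change MonoidalClosed.curry b ≫ _ = _
      rw [← MonoidalClosed.curry_natural_right, ← MonoidalClosed.curry_natural_left, hb]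
    · change MonoidalClosed.curry a ≫ _ = _
      rw [← MonoidalClosed.curry_natural_right, ← MonoidalClosed.curry_natural_left, ha])
  have e1 : X ◁ stdSimplex.δ 1 ≫ MonoidalClosed.uncurry φ = b := by
    rw [← MonoidalClosed.uncurry_natural_left, h1 1 (by simp)]
    change MonoidalClosed.uncurry (MonoidalClosed.curry b) = b
    simp
  have e2 : X ◁ stdSimplex.δ 2 ≫ MonoidalClosed.uncurry φ = a := by
    rw [← MonoidalClosed.uncurry_natural_left, h1 2 (by simp)]
    change MonoidalClosed.uncurry (MonoidalClosed.curry a) = a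
    simp
  have w (i j : Fin 2) (k l : Fin 3) (h : stdSimplex.{u}.δ i ≫ stdSimplex.δ k =
      stdSimplex.δ j ≫ stdSimplex.δ l) (t : X ⊗ Δ[2] ⟶ E) :
      X ◁ stdSimplex.δ i ≫ X ◁ stdSimplex.δ k ≫ t = X ◁ stdSimplex.δ j ≫ X ◁ stdSimplex.δ l ≫ t := by
    have := congrArg (fun q => X ◁ q ≫ t) h
    simpa only [whiskerLeft_comp, Category.assoc] using this
  refine ⟨X ◁ stdSimplex.δ 0 ≫ MonoidalClosed.uncurry φ, ?_, ?_, ?_⟩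
  · apply fst_Δ0_cancel
    have := w 1 0 0 2 (stdSimplex.δ_comp_δ (i := 0) (j := 1) (by decide)).symm (MonoidalClosed.uncurry φ)
    rw [e2, whiskerLeft_δ_one, whiskerLeft_δ_zero, Category.assoc, Category.assoc] at this
    exact this
  · apply fst_Δ0_cancel
    have := w 0 0 0 1 (stdSimplex.δ_comp_δ (i := 0) (j := 0) (by decide)).symm (MonoidalClosed.uncurry φ)
    rw [e1, whiskerLeft_δ_zero, Category.assoc, Category.assoc] at this
    exact this
  · rw [Category.assoc, ← MonoidalClosed.uncurry_natural_right, h2]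
    simp

/-- Two morphisms of simplicial sets are (elementarily) homotopic if there is a homotopy
`X × Δ[1] ⟶ Y` from the first to the second. -/
def IsHtpc {X Y : SSet.{u}} (f g : X ⟶ Y) : Prop := Nonempty (SSet.Homotopy f g)

lemma isHtpc_iff {X Y : SSet.{u}} {f g : X ⟶ Y} :
    IsHtpc f g ↔ ∃ h : X ⊗ Δ[1] ⟶ Y, SSet.ι₀ ≫ h = f ∧ SSet.ι₁ ≫ h = g := by
  constructor
  · rintro ⟨H⟩
    exact ⟨H.h, H.h₀, H.h₁⟩
  · rintro ⟨h, h0, h1⟩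
    refine ⟨{ h := h, h₀ := h0, h₁ := h1, rel := ?_ }⟩
    ext n ⟨⟨x, hx⟩, _⟩
    exact hx.elim

lemma IsHtpc.swap {X Y : SSet.{u}} [KanComplex Y] {f g g' : X ⟶ Y}
    (h : IsHtpc f g) (h' : IsHtpc f g') : IsHtpc g g' := by
  rw [isHtpc_iff] at *
  obtain ⟨a, a0, a1⟩ := h
  obtain ⟨b, b0, b1⟩ := h'
  obtain ⟨c, c0, c1, -⟩ := fillHorn (Limits.terminal.from Y) a b (by rw [a0, b0])
    (Limits.terminal.from _) (by simp) (by simp)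
  exact ⟨c, by rw [c0, a1], by rw [c1, b1]⟩

lemma IsHtpc.refl {X Y : SSet.{u}} (f : X ⟶ Y) : IsHtpc f f :=
  isHtpc_iff.2 ⟨fst _ _ ≫ f, by simp, by simp⟩

lemma IsHtpc.eqv {X Y : SSet.{u}} [KanComplex Y] {f g : X ⟶ Y}
    (h : Relation.EqvGen IsHtpc f g) : IsHtpc f g := by
  induction h with
  | rel _ _ h => exact h
  | refl f => exact .refl f
  | symm _ _ _ h => exact h.swap (.refl _)
  | trans _ _ _ _ _ h h' => exact (h.swap (.refl _)).swap h'

lemma IsHtpc.comp {X Y Z : SSet.{u}} {f g : Y ⟶ Z} (h : IsHtpc f g) (e : X ⟶ Y) :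
    IsHtpc (e ≫ f) (e ≫ g) := by
  rw [isHtpc_iff] at *
  obtain ⟨a, rfl, rfl⟩ := h
  exact ⟨e ▷ _ ≫ a, by simp, by simp⟩

/-- The set `[X, K]` of homotopy classes of morphisms `X ⟶ K`: the quotient of the set of morphisms
by the equivalence relation generated by the existence of a homotopy. -/
def HtpyClasses (X K : SSet.{u}) : Type u := Quot (IsHtpc : (X ⟶ K) → (X ⟶ K) → Prop)

/-- The map `[Y, K] → [X, K]` given by precomposition with `f : X ⟶ Y`. -/
def HtpyClasses.precomp {X Y : SSet.{u}} (f : X ⟶ Y) (K : SSet.{u}) :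
    HtpyClasses Y K → HtpyClasses X K :=
  Quot.map (fun φ => f ≫ φ) (fun _ _ h => h.comp f)

/-- Weak homotopy equivalences of simplicial sets: the morphisms `f : X ⟶ Y` such that, for every
Kan complex `K`, precomposition with `f` is a bijection `[Y, K] → [X, K]`. -/
def IsWeakHtpyEquiv {X Y : SSet.{u}} (f : X ⟶ Y) : Prop :=
  ∀ K : SSet.{u}, KanComplex K → Function.Bijective (HtpyClasses.precomp f K)

lemma HtpyClasses.eq_iff {X K : SSet.{u}} [KanComplex K] {f g : X ⟶ K} :
    (Quot.mk _ f : HtpyClasses X K) = Quot.mk _ g ↔ IsHtpc f g :=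
  ⟨fun h => IsHtpc.eqv (Quot.eqvGen_exact h), fun h => Quot.sound h⟩

lemma horn_ι_eq_const : (Λ[1, 0] : Subcomplex.{u} _).ι = SSet.const (stdSimplex.obj₀Equiv.symm 0) := by
  ext ⟨m⟩ ⟨x, hx⟩
  induction m using SimplexCategory.rec with | _ m
  refine SSet.stdSimplex.ext (n := 1) _ _ fun i => ?_
  have h := (mem_horn_iff (n := 1) 0 x).1 hx
  change x i = 0
  by_contra h0
  apply h
  ext j
  simp only [Set.union_singleton, Set.mem_insert_iff, Set.mem_range, Set.mem_univ, iff_true]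
  have h1 : x i = 1 := by revert h0; generalize x i = y; revert y; decide
  have : j = 0 ∨ j = 1 := by revert j; decide
  rcases this with rfl | rfl
  · exact Or.inl rfl
  · exact Or.inr ⟨i, h1⟩

/-- The homotopy lifting property relative to a subcomplex. -/
lemma liftHtpy {C E B : SSet.{u}} (p : E ⟶ B) [Fibration p] (A : C.Subcomplex) (v : C ⟶ E)
    (H : C ⊗ Δ[1] ⟶ B) (hv : SSet.ι₀ ≫ H = v ≫ p) (G : (A : SSet) ⊗ Δ[1] ⟶ E)
    (hG : SSet.ι₀ ≫ G = A.ι ≫ v) (hGp : G ≫ p = A.ι ▷ _ ≫ H) :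
    ∃ L : C ⊗ Δ[1] ⟶ E, SSet.ι₀ ≫ L = v ∧ A.ι ▷ _ ≫ L = G ∧ L ≫ p = H := by
  have hT (Z : SSet.{u}) : Z ◁ (Λ[1, 0] : Subcomplex.{u} _).ι = fst _ _ ≫ SSet.ι₀ := by
    rw [horn_ι_eq_const]; rfl
  have an := anodyneExtensions_unionProd_ι A (Λ[1, 0] : Subcomplex.{u} _) (.horn_ι 0) p
    (by rwa [← HomotopicalAlgebra.fibration_iff])
  have sq := (Subcomplex.unionProd.isPushout A (Λ[1, 0] : Subcomplex.{u} _))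
  obtain ⟨d, d1, d2⟩ := sq.exists_desc (fst _ _ ≫ v) G (by
    rw [hT, Category.assoc, hG, whiskerRight_fst_assoc])
  have csq : CommSq d (A.unionProd (Λ[1, 0] : Subcomplex.{u} _)).ι p H := ⟨by
    apply sq.hom_ext
    · rw [← Category.assoc, d1, Subcomplex.unionProd.ι₁_ι_assoc, hT, Category.assoc, Category.assoc, hv]
    · rw [← Category.assoc, d2, Subcomplex.unionProd.ι₂_ι_assoc, hGp]⟩
  refine ⟨csq.lift, ?_, ?_, csq.fac_right⟩
  · have := congrArg (fun t => Subcomplex.unionProd.ι₁ A (Λ[1, 0] : Subcomplex.{u} _) ≫ t) csq.fac_left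
    simp only [Subcomplex.unionProd.ι₁_ι_assoc, d1, hT] at this
    have h' := congrArg (fun t => lift (𝟙 C) (SSet.const
      (SSet.yonedaEquiv (horn.ι (0 : Fin 2) 1 (by decide)))) ≫ t) this
    simpa using h'
  · have := congrArg (fun t => Subcomplex.unionProd.ι₂ A (Λ[1, 0] : Subcomplex.{u} _) ≫ t) csq.fac_left
    simpa only [Subcomplex.unionProd.ι₂_ι_assoc, d2] using this

/-- A Kan fibration between Kan complexes which is a weak homotopy equivalence has a section which is
also a homotopy inverse. -/
lemma exists_section {E B : SSet.{u}} (p : E ⟶ B) [Fibration p] [KanComplex E] [KanComplex B]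
    (h : IsWeakHtpyEquiv p) : ∃ s : B ⟶ E, s ≫ p = 𝟙 B ∧ IsHtpc (p ≫ s) (𝟙 E) := by
  obtain ⟨⟨r⟩, hr⟩ := (h E inferInstance).2 (Quot.mk _ (𝟙 E))
  have hr : IsHtpc (p ≫ r) (𝟙 E) := HtpyClasses.eq_iff.1 hr
  have hr' : IsHtpc (r ≫ p) (𝟙 B) := by
    apply HtpyClasses.eq_iff.1
    apply (h B inferInstance).1
    apply HtpyClasses.eq_iff.2
    rw [isHtpc_iff] at hr ⊢
    obtain ⟨a, a0, a1⟩ := hr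
    exact ⟨a ≫ p, by simp [reassoc_of% a0], by simp [reassoc_of% a1]⟩
  obtain ⟨H, H0, H1⟩ := isHtpc_iff.1 hr'
  obtain ⟨L, L0, -, L2⟩ := liftHtpy p ⊥ r H H0
    (fst _ _ ≫ (⊥ : B.Subcomplex).ι ≫ r) (by simp) (by
      ext n ⟨⟨x, hx⟩, _⟩
      exact hx.elim)
  refine ⟨SSet.ι₁ ≫ L, by rw [Category.assoc, L2, H1], ?_⟩
  have : IsHtpc r (SSet.ι₁ ≫ L) := isHtpc_iff.2 ⟨L, L0, rfl⟩
  exact (this.comp p).swap hr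

/-- A Kan fibration between Kan complexes which is a weak homotopy equivalence is a trivial
Kan fibration. -/
lemma rlp_of_weakHtpyEquiv {E B : SSet.{u}} (p : E ⟶ B) [Fibration p] [KanComplex E] [KanComplex B]
    (h : IsWeakHtpyEquiv p) : I.rlp p := by
  obtain ⟨s, hs, H⟩ := exists_section p h
  obtain ⟨K, K0, K1⟩ := isHtpc_iff.1 H
  have w2 (t : E ⊗ Δ[1] ⟶ B) : E ◁ stdSimplex.δ 2 ≫ E ◁ stdSimplex.σ 1 ≫ t = t := by
    have := congrArg (fun q => E ◁ q ≫ t) (stdSimplex.{u}.δ_comp_σ_succ (i := (1 : Fin 2)))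
    simp only [whiskerLeft_comp, Category.assoc, whiskerLeft_id, Category.id_comp] at this
    exact this
  have w1 (t : E ⊗ Δ[1] ⟶ B) : E ◁ stdSimplex.δ 1 ≫ E ◁ stdSimplex.σ 1 ≫ t = t := by
    have := congrArg (fun q => E ◁ q ≫ t) (stdSimplex.{u}.δ_comp_σ_self (i := (1 : Fin 2)))
    simp only [whiskerLeft_comp, Category.assoc, whiskerLeft_id, Category.id_comp] at this
    exact this
  have w0 (t : E ⊗ Δ[1] ⟶ B) : E ◁ stdSimplex.δ 0 ≫ E ◁ stdSimplex.σ 1 ≫ t =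
      E ◁ stdSimplex.σ 0 ≫ E ◁ stdSimplex.δ 0 ≫ t := by
    have := congrArg (fun q => E ◁ q ≫ t) (stdSimplex.{u}.δ_comp_σ_of_le (i := (0 : Fin 2)) (j := (0 : Fin 1)) (by decide))
    simp only [whiskerLeft_comp, Category.assoc] at this
    exact this
  obtain ⟨L, L0, L1, L2⟩ := fillHorn p (K ≫ p ≫ s) K (by simp [reassoc_of% K0, K0, reassoc_of% hs])
    (E ◁ stdSimplex.σ 1 ≫ K ≫ p) (by rw [w2]; simp [hs]) (by rw [w1])
  have L2' : L ≫ p = fst _ _ ≫ p := by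
    rw [L2, w0, whiskerLeft_δ_zero, Category.assoc, reassoc_of% K1, whiskerLeft_fst_assoc]
  rintro _ _ _ ⟨n⟩
  constructor
  intro a c sq
  have sqw := sq.w
  obtain ⟨M, M0, M1, M2⟩ := liftHtpy p ∂Δ[n] (c ≫ s) (fst _ _ ≫ c) (by simp [hs])
    (a ▷ _ ≫ L) (by
      rw [← Category.assoc, SSet.ι₀_comp, Category.assoc, L0, reassoc_of% K1, ← Category.assoc, sqw, Category.assoc])
    (by rw [Category.assoc, L2', whiskerRight_fst_assoc, whiskerRight_fst_assoc, sqw])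
  refine ⟨⟨⟨SSet.ι₁ ≫ M, ?_, ?_⟩⟩⟩
  · rw [← Category.assoc, ← SSet.ι₁_comp, Category.assoc, M1, ← Category.assoc, SSet.ι₁_comp, Category.assoc, L1, K1, Category.comp_id]
  · rw [Category.assoc, M2]; simp

/-- Bisimplicial sets, as simplicial objects in the category of simplicial sets. The set `X_{n,m}` is
`(X _⦋n⦌) _⦋m⦌`. The `n`-th column `X_{n,•}` is the simplicial set `X _⦋n⦌`, and the `m`-th row
`X_{•,m}` is the simplicial set `X.flip.obj (op ⦋m⦌)`. -/
abbrev SSSet : Type (u + 1) := SimplicialObject SSet.{u}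

/-- The simplicial set `M_v(A, X)`, whose set of `m`-simplices is the set of morphisms from `A` to the
`m`-th row of `X`. -/
def Mv (A : SSet.{u}) (X : SSSet.{u}) : SSet.{u} :=
  X.flip ⋙ coyoneda.obj (op A)

/-- The morphism `M_v(B, X) ⟶ M_v(A, X)` induced by `i : A ⟶ B`. -/
def Mv.map {A B : SSet.{u}} (i : A ⟶ B) (X : SSSet.{u}) : Mv B X ⟶ Mv A X :=
  Functor.whiskerLeft X.flip (coyoneda.map i.op)

/-- A morphism `W ⟶ M_v(A, X)` is the same thing as a morphism from the exterior product of `A` and `W`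
to `X`, hence as a morphism `A ⟶ M_v(W, X.flip)`. -/
def Mv.swap {A W : SSet.{u}} {X : SSSet.{u}} (φ : W ⟶ Mv A X) : A ⟶ Mv W X.flip where
  app n := ↾fun a =>
    { app m := ↾fun w => ((φ.app m w : A ⟶ X.flip.obj m)).app n a
      naturality m m' f := by
        ext w
        have := ConcreteCategory.congr_hom (φ.naturality f) w
        exact congrArg (fun t : A ⟶ X.flip.obj m' => t.app n a) this }
  naturality n n' f := by
    ext a
    apply NatTrans.ext
    funext m
    ext w
    exact ConcreteCategory.congr_hom ((φ.app m w : A ⟶ X.flip.obj m).naturality f) a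

lemma Mv.lifting_swap {A A' W W' : SSet.{u}} {X : SSSet.{u}} (i : A' ⟶ A) (j : W' ⟶ W)
    (h : HasLiftingProperty i (Mv.map j X.flip)) : HasLiftingProperty j (Mv.map i X) := by
  constructor
  intro a c sq
  have sqw := sq.w
  have sq' : CommSq (Mv.swap c) i (Mv.map j X.flip) (Mv.swap a) :=
    ⟨(congrArg Mv.swap sqw).symm⟩
  refine ⟨⟨⟨Mv.swap sq'.lift, ?_, ?_⟩⟩⟩
  · exact congrArg Mv.swap sq'.fac_right
  · exact congrArg Mv.swap sq'.fac_left

/-- Fibrancy in the vertical Reedy model structure: for every `n`, the matching morphism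
`X_{n,•} = M_v(Δ[n], X) ⟶ M_v(∂Δ[n], X)` is a Kan fibration. -/
def IsVerticallyReedyFibrant (X : SSSet.{u}) : Prop :=
  ∀ n : ℕ, Fibration (Mv.map ∂Δ[n].ι X)

/-- The spine of `Δ[n]`: the union of the edges `{i, i + 1}`. -/
def spine (n : ℕ) : (Δ[n] : SSet.{u}).Subcomplex :=
  ⨆ i : Fin n, Subcomplex.ofSimplex (stdSimplex.edge n i.castSucc i.succ i.castSucc_lt_succ.le)

/-- The Segal condition: for `n ≥ 1`, the morphism `M_v(Δ[n], X) ⟶ M_v(G, X)` induced by the inclusion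
of the spine `G` of `Δ[n]` is a weak homotopy equivalence. -/
def SegalCondition (X : SSSet.{u}) : Prop :=
  ∀ n : ℕ, 1 ≤ n → IsWeakHtpyEquiv (Mv.map (spine n).ι X)

/-- Segal spaces: vertically Reedy fibrant bisimplicial sets satisfying the Segal condition. -/
class IsSegalSpace (X : SSSet.{u}) : Prop where
  reedyFibrant : IsVerticallyReedyFibrant X
  segal : SegalCondition X

lemma IsVerticallyReedyFibrant.fibration {X : SSSet.{u}} (hX : IsVerticallyReedyFibrant X)
    {A B : SSet.{u}} (i : A ⟶ B) [Mono i] : Fibration (Mv.map i X) := by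
  rw [fibration_iff]
  intro _ _ j hj
  apply Mv.lifting_swap
  have : (MorphismProperty.monomorphisms SSet.{u}).rlp (Mv.map j X.flip) := by
    have key (n : ℕ) : HasLiftingProperty ∂Δ[n].ι (Mv.map j X.flip) := by
      apply Mv.lifting_swap (X := X.flip)
      exact (fibration_iff _).1 (hX n) _ hj
    rw [rlp_monomorphisms]
    rintro _ _ _ ⟨n⟩
    exact key n
  exact this i inferInstance

lemma IsVerticallyReedyFibrant.kanComplex {X : SSSet.{u}} (hX : IsVerticallyReedyFibrant X)
    (A : SSet.{u}) : KanComplex (Mv A X) := by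
  have := hX.fibration (⊥ : A.Subcomplex).ι
  have t : Limits.IsTerminal (Mv ((⊥ : A.Subcomplex) : SSet.{u}) X) := by
    refine Limits.IsTerminal.ofUniqueHom (fun Y => ⟨fun m => ↾fun _ => Subcomplex.isInitialBot.to _, ?_⟩) ?_
    · intro m m' f
      ext y
      exact Subcomplex.isInitialBot.hom_ext (Y := X.flip.obj m') _ _
    · intro Y f
      ext m y
      exact Subcomplex.isInitialBot.hom_ext (Y := X.flip.obj m) _ _
  exact (isFibrant_iff_of_isTerminal (Mv.map (⊥ : A.Subcomplex).ι X) t).2 this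

lemma IsSegalSpace.rlp (X : SSSet.{u}) [hX : IsSegalSpace X] {n : ℕ} (hn : 1 ≤ n) :
    I.rlp (Mv.map (spine n).ι X) := by
  have := hX.reedyFibrant.fibration (spine n).ι
  have := hX.reedyFibrant.kanComplex Δ[n]
  have := hX.reedyFibrant.kanComplex (spine n)
  exact rlp_of_weakHtpyEquiv _ (hX.segal n hn)

lemma principalEdge_apply {n : ℕ} (i : Fin n) {m : ℕ} (y : (Δ[1] : SSet.{u}) _⦋m⦌) (k : Fin (m + 1)) :
    ((SSet.yonedaEquiv.symm (stdSimplex.edge.{u} n i.castSucc i.succ i.castSucc_lt_succ.le)).app (op ⦋m⦌) y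
      : Δ[n] _⦋m⦌) k = if y k = 0 then i.castSucc else i.succ := by
  change (![i.castSucc, i.succ] : Fin 2 → Fin (n + 1)) (y k) = _
  generalize y k = z
  revert z
  rw [Fin.forall_fin_two]
  exact ⟨rfl, rfl⟩

lemma eq_const_of {n m : ℕ} (y : (Δ[n] : SSet.{u}) _⦋m⦌) (a : Fin (n + 1)) (h : ∀ k, y k = a) :
    y = stdSimplex.const n a _ :=
  SSet.stdSimplex.ext _ _ fun k => h k

lemma spine_wd {n : ℕ} {R : SSet.{u}} (e : Fin n → R _⦋1⦌)
    (he : ∀ i j : Fin n, i.val + 1 = j.val → R.δ 0 (e i) = R.δ 1 (e j))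
    {m : ℕ} (i j : Fin n) (y y' : (Δ[1] : SSet.{u}) _⦋m⦌)
    (h : (SSet.yonedaEquiv.symm (stdSimplex.edge.{u} n i.castSucc i.succ i.castSucc_lt_succ.le)).app (op ⦋m⦌) y =
      (SSet.yonedaEquiv.symm (stdSimplex.edge.{u} n j.castSucc j.succ j.castSucc_lt_succ.le)).app (op ⦋m⦌) y') :
    (SSet.yonedaEquiv.symm (e i)).app (op ⦋m⦌) y = (SSet.yonedaEquiv.symm (e j)).app (op ⦋m⦌) y' := by
  have h' (k : Fin (m + 1)) : (if y k = 0 then i.castSucc else i.succ) =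
      (if y' k = 0 then j.castSucc else j.succ) := by
    rw [← principalEdge_apply, ← principalEdge_apply, h]
  have c1 (v : Fin 2) (hv : v ≠ 0) : v = 1 := by revert v; decide
  have key (i j : Fin n) (hij : i < j) (y y' : (Δ[1] : SSet.{u}) _⦋m⦌)
      (h' : ∀ k : Fin (m + 1), (if y k = 0 then i.castSucc else i.succ) =
      (if y' k = 0 then j.castSucc else j.succ)) :
      (SSet.yonedaEquiv.symm (e i)).app (op ⦋m⦌) y = (SSet.yonedaEquiv.symm (e j)).app (op ⦋m⦌) y' := by
    have a (k : Fin (m + 1)) : y k = 1 ∧ y' k = 0 ∧ i.val + 1 = j.val := by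
      have := h' k
      split_ifs at this with h1 h2 h2 <;> simp only [Fin.ext_iff, Fin.val_castSucc, Fin.val_succ] at this
      · omega
      · omega
      · exact ⟨c1 _ h1, h2, this⟩
      · omega
    have hy := eq_const_of y 1 (fun k => (a k).1)
    have hy' := eq_const_of y' 0 (fun k => (a k).2.1)
    have e1 := congrArg (fun t => t.app (op ⦋m⦌) (stdSimplex.const 0 0 _))
      (stdSimplex.δ_comp_yonedaEquiv_symm (e i) 0)
    have e2 := congrArg (fun t => t.app (op ⦋m⦌) (stdSimplex.const 0 0 _))
      (stdSimplex.δ_comp_yonedaEquiv_symm (e j) 1)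
    rw [hy, hy']
    rw [he i j (a 0).2.2] at e1
    exact e1.trans e2.symm
  rcases lt_trichotomy i j with hij | rfl | hij
  · exact key i j hij y y' h'
  · congr 1
    refine SSet.stdSimplex.ext _ _ fun k => ?_
    have := h' k
    split_ifs at this with h1 h2 h2 <;> simp only [Fin.ext_iff, Fin.val_castSucc, Fin.val_succ] at this
    · rw [h1, h2]
    · omega
    · omega
    · rw [c1 _ h1, c1 _ h2]
  · exact (key j i hij y' y (fun k => (h' k).symm)).symm

lemma spine_mem {n : ℕ} {m : SimplexCategoryᵒᵖ} (x : (spine.{u} n : SSet.{u}).obj m) :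
    ∃ (i : Fin n) (y : (Δ[1] : SSet.{u}).obj m), (SSet.yonedaEquiv.symm
      (stdSimplex.edge.{u} n i.castSucc i.succ i.castSucc_lt_succ.le)).app m y = x.1 := by
  obtain ⟨x, hx⟩ := x
  simp only [spine, Subfunctor.iSup_obj, Set.mem_iUnion] at hx
  obtain ⟨i, hi⟩ := hx
  obtain ⟨θ, hθ⟩ := hi
  exact ⟨i, stdSimplex.objEquiv.symm θ.unop, hθ⟩

lemma mem_spine {n : ℕ} (i : Fin n) :
    stdSimplex.edge.{u} n i.castSucc i.succ i.castSucc_lt_succ.le ∈ (spine n).obj (op ⦋1⦌) := by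
  simp only [spine, Subfunctor.iSup_obj, Set.mem_iUnion]
  exact ⟨i, Subcomplex.mem_ofSimplex_obj _⟩

lemma exists_spine_desc {n : ℕ} {R : SSet.{u}} (e : Fin n → R _⦋1⦌)
    (he : ∀ i j : Fin n, i.val + 1 = j.val → R.δ 0 (e i) = R.δ 1 (e j)) :
    ∃ g : (spine n : SSet.{u}) ⟶ R, ∀ i : Fin n, g.app (op ⦋1⦌) ⟨_, mem_spine i⟩ = e i := by
  choose I Y hIY using @spine_mem.{u} n
  refine ⟨⟨fun m => ↾fun x => (SSet.yonedaEquiv.symm (e (I x))).app m (Y x), ?_⟩, ?_⟩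
  · intro m m' f
    ext x
    change (SSet.yonedaEquiv.symm (e (I _))).app m' (Y _) =
      R.map f ((SSet.yonedaEquiv.symm (e (I x))).app m (Y x))
    rw [← NatTrans.naturality_apply]
    induction m' using Opposite.rec with | _ m'
    induction m' using SimplexCategory.rec with | _ m'
    apply spine_wd e he
    rw [hIY, NatTrans.naturality_apply, hIY]
    rfl
  · intro i
    have := spine_wd e he (m := 1) (I ⟨_, mem_spine i⟩) i (Y ⟨_, mem_spine i⟩) (SSet.yonedaEquiv (𝟙 _)) (by
      exact (hIY _).trans (SSet.yonedaEquiv_symm_app_id (X := Δ[n]) (n := 1) _).symm)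
    rw [SSet.yonedaEquiv_symm_app_id] at this
    exact this

lemma exists_boundary_desc {W : SSet.{u}} (a b : W _⦋0⦌) :
    ∃ g : ((∂Δ[1] : Subcomplex.{u} _) : SSet.{u}) ⟶ W,
      boundary.ι 1 ≫ g = SSet.yonedaEquiv.symm a ∧ boundary.ι 0 ≫ g = SSet.yonedaEquiv.symm b := by
  classical
  let v (m : SimplexCategoryᵒᵖ) (x : ((∂Δ[1] : Subcomplex.{u} _) : SSet.{u}).obj m) : Fin 2 :=
    (stdSimplex.objEquiv x.1).toOrderHom 0
  have hv (m : SimplexCategoryᵒᵖ) (x : ((∂Δ[1] : Subcomplex.{u} _) : SSet.{u}).obj m)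
     (k) : (stdSimplex.objEquiv x.1).toOrderHom k = v m x := by
    by_contra hk
    apply x.2
    intro t
    have : ∀ p q t : Fin 2, p ≠ q → t = p ∨ t = q := by decide
    rcases this _ _ t hk with h | h
    · exact ⟨k, h.symm⟩
    · exact ⟨0, h.symm⟩
  have e (t : W _⦋0⦌) : W.map (SimplexCategory.const ⦋0⦌ ⦋0⦌ 0).op t = t := by
    have : SimplexCategory.const ⦋0⦌ ⦋0⦌ 0 = 𝟙 _ := by ext; simp
    rw [this]
    simp
  refine ⟨⟨fun m => ↾fun x => W.map (SimplexCategory.const m.unop ⦋0⦌ 0).op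
    (if v m x = 0 then a else b), ?_⟩, ?_, ?_⟩
  · intro m m' f
    ext x
    have : v m' (((∂Δ[1] : Subcomplex.{u} _) : SSet.{u}).map f x) = v m x := by
      rw [← hv m x (f.unop.toOrderHom 0)]
      rfl
    trans W.map (SimplexCategory.const m'.unop ⦋0⦌ 0).op (if v m x = 0 then a else b)
    · exact congrArg (fun t : Fin 2 => W.map (SimplexCategory.const m'.unop ⦋0⦌ 0).op
        (if t = 0 then a else b)) this
    · change _ = W.map f (W.map _ (if v m x = 0 then a else b))
      rw [← Functor.map_comp_apply]
      rfl
  · apply SSet.yonedaEquiv.injective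
    rw [Equiv.apply_symm_apply]
    exact e a
  · apply SSet.yonedaEquiv.injective
    rw [Equiv.apply_symm_apply]
    exact e b

lemma exists_vertex_lift {E B : SSet.{u}} {p : E ⟶ B} (hp : I.rlp p) (b : B _⦋0⦌) :
    ∃ a, p.app _ a = b := by
  have := hp _ (boundary_ι_mem_I 0)
  have hinit : ∀ x : SimplexCategoryᵒᵖ, ((∂Δ[0] : Subcomplex.{u} _) : SSet.{u}).obj x → False := by
    intro x y
    exact y.2 fun t => ⟨0, Subsingleton.elim (α := Fin 1) _ _⟩
  let g : ((∂Δ[0] : Subcomplex.{u} _) : SSet.{u}) ⟶ E :=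
    ⟨fun m => ↾fun x => (hinit m x).elim, fun m m' f => by ext x; exact (hinit m x).elim⟩
  have sq : CommSq g (∂Δ[0] : Subcomplex.{u} _).ι p (SSet.yonedaEquiv.symm b) := ⟨boundary.hom_ext₀⟩
  refine ⟨SSet.yonedaEquiv sq.lift, ?_⟩
  rw [← SSet.yonedaEquiv_comp, sq.fac_right, Equiv.apply_symm_apply]

lemma exists_edge_lift {E B : SSet.{u}} {p : E ⟶ B} (hp : I.rlp p) (a₀ a₁ : E _⦋0⦌) (b : B _⦋1⦌)
    (h₀ : B.δ 1 b = p.app _ a₀) (h₁ : B.δ 0 b = p.app _ a₁) :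
    ∃ a, p.app _ a = b ∧ E.δ 1 a = a₀ ∧ E.δ 0 a = a₁ := by
  have := hp _ (boundary_ι_mem_I 1)
  obtain ⟨g, hg1, hg0⟩ := exists_boundary_desc a₀ a₁
  have sq : CommSq g (∂Δ[1] : Subcomplex.{u} _).ι p (SSet.yonedaEquiv.symm b) := ⟨by
    apply boundary.hom_ext
    rw [Fin.forall_fin_two]
    constructor
    · rw [← Category.assoc, hg0, ← Category.assoc, boundary.ι_ι, stdSimplex.δ_comp_yonedaEquiv_symm,
        h₁, SSet.yonedaEquiv_symm_comp]
    · rw [← Category.assoc, hg1, ← Category.assoc, boundary.ι_ι, stdSimplex.δ_comp_yonedaEquiv_symm,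
        h₀, SSet.yonedaEquiv_symm_comp]⟩
  refine ⟨SSet.yonedaEquiv sq.lift, ?_, ?_, ?_⟩
  · rw [← SSet.yonedaEquiv_comp, sq.fac_right, Equiv.apply_symm_apply]
  · have := congrArg (fun t => SSet.yonedaEquiv (boundary.ι 1 ≫ t)) sq.fac_left
    change SSet.yonedaEquiv (boundary.ι 1 ≫ _ ≫ _) = SSet.yonedaEquiv (boundary.ι 1 ≫ g) at this
    rw [hg1, Equiv.apply_symm_apply, ← Category.assoc, boundary.ι_ι, stdSimplex.yonedaEquiv_δ_comp] at this
    exact this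
  · have := congrArg (fun t => SSet.yonedaEquiv (boundary.ι 0 ≫ t)) sq.fac_left
    change SSet.yonedaEquiv (boundary.ι 0 ≫ _ ≫ _) = SSet.yonedaEquiv (boundary.ι 0 ≫ g) at this
    rw [hg0, Equiv.apply_symm_apply, ← Category.assoc, boundary.ι_ι, stdSimplex.yonedaEquiv_δ_comp] at this
    exact this

/-- The `i`-th principal edge operator `[1] ⟶ [n]`. -/
def prinEdge {n : ℕ} (i : Fin n) : ⦋1⦌ ⟶ ⦋n⦌ :=
  SimplexCategory.mkHom ⟨![i.castSucc, i.succ], by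
    rw [Fin.monotone_iff_le_succ]
    intro k
    fin_cases k
    exact i.castSucc_lt_succ.le⟩

lemma IsSegalSpace.exists_vertex (X : SSSet.{u}) [IsSegalSpace X] {n : ℕ} (hn : 1 ≤ n)
    (e : Fin n → (X _⦋1⦌) _⦋0⦌)
    (he : ∀ i j : Fin n, i.val + 1 = j.val → (X.δ 0).app _ (e i) = (X.δ 1).app _ (e j)) :
    ∃ s : (X _⦋n⦌) _⦋0⦌, ∀ i, (X.map (prinEdge i).op).app _ s = e i := by
  obtain ⟨g, hg⟩ := exists_spine_desc (R := X.flip.obj (op ⦋0⦌)) e he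
  obtain ⟨a, ha⟩ := exists_vertex_lift (IsSegalSpace.rlp X hn) g
  change Δ[n] ⟶ X.flip.obj (op ⦋0⦌) at a
  change (spine n).ι ≫ a = g at ha
  refine ⟨SSet.yonedaEquiv (X := X.flip.obj (op ⦋0⦌)) (n := ⦋n⦌) a, fun i => ?_⟩
  rw [← hg, ← ha]
  exact SSet.yonedaEquiv_naturality (prinEdge i) a

lemma IsSegalSpace.exists_edge (X : SSSet.{u}) [IsSegalSpace X] {n : ℕ} (hn : 1 ≤ n)
    (e : Fin n → (X _⦋1⦌) _⦋1⦌)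
    (he : ∀ i j : Fin n, i.val + 1 = j.val → (X.δ 0).app _ (e i) = (X.δ 1).app _ (e j))
    (s₀ s₁ : (X _⦋n⦌) _⦋0⦌) (h₀ : ∀ i, (X.map (prinEdge i).op).app _ s₀ = (X _⦋1⦌).δ 1 (e i))
    (h₁ : ∀ i, (X.map (prinEdge i).op).app _ s₁ = (X _⦋1⦌).δ 0 (e i)) :
    ∃ s : (X _⦋n⦌) _⦋1⦌, (X _⦋n⦌).δ 1 s = s₀ ∧ (X _⦋n⦌).δ 0 s = s₁ ∧
      ∀ i, (X.map (prinEdge i).op).app _ s = e i := by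
  obtain ⟨g, hg⟩ := exists_spine_desc (R := X.flip.obj (op ⦋1⦌)) e he
  have ext {m : ℕ} (f f' : (spine n : SSet.{u}) ⟶ X.flip.obj (op ⦋m⦌))
      (h : ∀ i, f.app (op ⦋1⦌) ⟨_, mem_spine i⟩ = f'.app (op ⦋1⦌) ⟨_, mem_spine i⟩) : f = f' := by
    ext k x
    obtain ⟨i, y, hy⟩ := spine_mem x
    have hx : x = (spine n : SSet.{u}).map (stdSimplex.objEquiv y).op ⟨_, mem_spine i⟩ := Subtype.ext hy.symm
    rw [hx]
    refine (NatTrans.naturality_apply f _ _).trans (Eq.trans ?_ (NatTrans.naturality_apply f' _ _).symm)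
    rw [h i]
  obtain ⟨a, ha, ha0, ha1⟩ := exists_edge_lift (IsSegalSpace.rlp X hn)
    ((SSet.yonedaEquiv (X := X.flip.obj (op ⦋0⦌)) (n := ⦋n⦌)).symm s₀)
    ((SSet.yonedaEquiv (X := X.flip.obj (op ⦋0⦌)) (n := ⦋n⦌)).symm s₁) g
    (ext _ _ fun i => by
      refine Eq.trans ?_ (h₀ i).symm
      exact congrArg ((X _⦋1⦌).δ 1) (hg i))
    (ext _ _ fun i => by
      refine Eq.trans ?_ (h₁ i).symm
      exact congrArg ((X _⦋1⦌).δ 0) (hg i))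
  change Δ[n] ⟶ X.flip.obj (op ⦋1⦌) at a
  change (spine n).ι ≫ a = g at ha
  refine ⟨SSet.yonedaEquiv (X := X.flip.obj (op ⦋1⦌)) (n := ⦋n⦌) a, ?_, ?_, fun i => ?_⟩
  · have := congrArg SSet.yonedaEquiv ha0
    rw [Equiv.apply_symm_apply] at this
    exact this
  · have := congrArg SSet.yonedaEquiv ha1
    rw [Equiv.apply_symm_apply] at this
    exact this
  · rw [← hg, ← ha]
    exact SSet.yonedaEquiv_naturality (prinEdge i) a

/-- The simplicial set `X(x₀, …, xₙ)`, the fibre of `X_{n,•} ⟶ X_{0,•} × ⋯ × X_{0,•}` over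
`(x₀, …, xₙ)`. It consists of those simplices of the `n`-th column whose images under the `n + 1`
vertex operators `X_{n,•} ⟶ X_{0,•}` are the totally degenerate simplices on `x₀, …, xₙ`. -/
def mapSpace (X : SSSet.{u}) {n : ℕ} (x : Fin (n + 1) → (X _⦋0⦌) _⦋0⦌) : (X _⦋n⦌).Subcomplex where
  obj m := {s | ∀ i : Fin (n + 1), (X.map (SimplexCategory.const ⦋0⦌ ⦋n⦌ i).op).app m s =
    (X _⦋0⦌).map (SimplexCategory.const m.unop ⦋0⦌ 0).op (x i)}
  map {m m'} f s hs i := by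
    refine (NatTrans.naturality_apply (X.map (SimplexCategory.const ⦋0⦌ ⦋n⦌ i).op) f s).trans ?_
    rw [hs i, ← Functor.map_comp_apply]
    rfl

/-- The morphism `X(x) ⟶ X(y)` induced by a horizontal simplicial operator `θ : [k] ⟶ [n]`, where
`y = x ∘ θ`. -/
def mapSpace.restrict (X : SSSet.{u}) {n k : ℕ} (θ : ⦋k⦌ ⟶ ⦋n⦌) (x : Fin (n + 1) → (X _⦋0⦌) _⦋0⦌)
    (y : Fin (k + 1) → (X _⦋0⦌) _⦋0⦌) (h : ∀ i, y i = x (θ i)) :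
    (mapSpace X x : SSet.{u}) ⟶ (mapSpace X y : SSet.{u}) :=
  Subcomplex.lift ((mapSpace X x).ι ≫ X.map θ.op) (by
    rintro m _ ⟨s, rfl⟩ i
    change (X.map (SimplexCategory.const ⦋0⦌ ⦋k⦌ i).op).app m ((X.map θ.op).app m s.1) = _
    rw [h i, ← s.2 (θ i), ← NatTrans.comp_app_apply, ← X.map_comp, ← op_comp]
    rfl)

/-- The homotopy category of a Segal space. Its objects are the vertices of the `0`-th column. -/
def Ho (X : SSSet.{u}) : Type u := (X _⦋0⦌) _⦋0⦌

namespace Ho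

/-- The morphisms `x ⟶ y` in the homotopy category: the connected components of `X(x, y)`. -/
abbrev Hom (X : SSSet.{u}) (x y : (X _⦋0⦌) _⦋0⦌) : Type u :=
  π₀ (mapSpace X ![x, y] : SSet.{u})

lemma const_zero : SimplexCategory.const ⦋0⦌ ⦋0⦌ 0 = 𝟙 _ := by ext; simp

lemma map_const_zero {X : SSSet.{u}} {n : ℕ} (t : (X _⦋n⦌) _⦋0⦌) :
    (X _⦋n⦌).map (SimplexCategory.const ⦋0⦌ ⦋0⦌ 0).op t = t := by
  rw [const_zero]
  simp

lemma const_δ (i : Fin 2) : SimplexCategory.const ⦋0⦌ ⦋1⦌ i = SimplexCategory.δ (Fin.rev i) := by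
  fin_cases i <;> (ext k; fin_cases k; rfl)

lemma mem_mapSpace {X : SSSet.{u}} {x y : (X _⦋0⦌) _⦋0⦌} (e : (X _⦋1⦌) _⦋0⦌)
    (h₁ : (X.δ 1).app _ e = x) (h₀ : (X.δ 0).app _ e = y) :
    e ∈ (mapSpace X ![x, y]).obj (op ⦋0⦌) := by
  intro i
  rw [const_δ]
  refine Eq.trans ?_ (map_const_zero (n := 0) _).symm
  fin_cases i
  · exact h₁
  · exact h₀

lemma of_mem {X : SSSet.{u}} {x y : (X _⦋0⦌) _⦋0⦌} {m : ℕ} {e : (X _⦋1⦌) _⦋m⦌}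
    (h : e ∈ (mapSpace X ![x, y]).obj (op ⦋m⦌)) :
    (X.δ 1).app _ e = (X _⦋0⦌).map (SimplexCategory.const ⦋m⦌ ⦋0⦌ 0).op x ∧
    (X.δ 0).app _ e = (X _⦋0⦌).map (SimplexCategory.const ⦋m⦌ ⦋0⦌ 0).op y := by
  have h0 := h 0
  have h1 := h 1
  rw [const_δ] at h0 h1
  exact ⟨h0, h1⟩

/-- The identity of `x`: the connected component of the degenerate vertex `s₀ x` of `X(x, x)`. -/
def id (X : SSSet.{u}) (x : (X _⦋0⦌) _⦋0⦌) : Hom X x x :=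
  π₀.mk ⟨(X.σ 0).app _ x, mem_mapSpace _
    (by rw [← NatTrans.comp_app_apply, SimplicialObject.δ_comp_σ_succ' (j := 1) (i := 0) _ rfl]; rfl)
    (by rw [← NatTrans.comp_app_apply, SimplicialObject.δ_comp_σ_self' (j := 0) (i := 0) _ rfl]; rfl)⟩

/-- The morphism `X(x, y, z) ⟶ X(x, y)` induced by the face operator `d₂`. -/
def face₂ (X : SSSet.{u}) (x y z : (X _⦋0⦌) _⦋0⦌) :
    (mapSpace X ![x, y, z] : SSet.{u}) ⟶ (mapSpace X ![x, y] : SSet.{u}) :=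
  mapSpace.restrict X (SimplexCategory.δ 2) _ _ (fun i => by fin_cases i <;> rfl)

/-- The morphism `X(x, y, z) ⟶ X(y, z)` induced by the face operator `d₀`. -/
def face₀ (X : SSSet.{u}) (x y z : (X _⦋0⦌) _⦋0⦌) :
    (mapSpace X ![x, y, z] : SSet.{u}) ⟶ (mapSpace X ![y, z] : SSet.{u}) :=
  mapSpace.restrict X (SimplexCategory.δ 0) _ _ (fun i => by fin_cases i <;> rfl)

/-- The morphism `X(x, y, z) ⟶ X(x, z)` induced by the face operator `d₁`. -/
def face₁ (X : SSSet.{u}) (x y z : (X _⦋0⦌) _⦋0⦌) :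
    (mapSpace X ![x, y, z] : SSet.{u}) ⟶ (mapSpace X ![x, z] : SSet.{u}) :=
  mapSpace.restrict X (SimplexCategory.δ 1) _ _ (fun i => by fin_cases i <;> rfl)

lemma prinEdge_two_zero : prinEdge (n := 2) 0 = SimplexCategory.δ 2 := by
  ext k; fin_cases k <;> rfl
lemma prinEdge_two_one : prinEdge (n := 2) 1 = SimplexCategory.δ 0 := by
  ext k; fin_cases k <;> rfl

lemma mem_of_faces {X : SSSet.{u}} {x y z : (X _⦋0⦌) _⦋0⦌} {m : ℕ} (s : (X _⦋2⦌) _⦋m⦌)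
    (h₂ : (X.δ 2).app _ s ∈ (mapSpace X ![x, y]).obj (op ⦋m⦌))
    (h₀ : (X.δ 0).app _ s ∈ (mapSpace X ![y, z]).obj (op ⦋m⦌)) :
    s ∈ (mapSpace X ![x, y, z]).obj (op ⦋m⦌) := by
  intro i
  have key (k : Fin 2) (j : Fin 3) (h : SimplexCategory.const ⦋0⦌ ⦋2⦌ i =
      SimplexCategory.const ⦋0⦌ ⦋1⦌ k ≫ SimplexCategory.δ j) :
      (X.map (SimplexCategory.const ⦋0⦌ ⦋2⦌ i).op).app _ s =
        (X.map (SimplexCategory.const ⦋0⦌ ⦋1⦌ k).op).app _ ((X.δ j).app _ s) := by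
    rw [h, op_comp, X.map_comp]
    rfl
  fin_cases i
  · rw [key 0 2 (by ext k; fin_cases k; rfl)]
    exact h₂ 0
  · rw [key 1 2 (by ext k; fin_cases k; rfl)]
    exact h₂ 1
  · rw [key 1 0 (by ext k; fin_cases k; rfl)]
    exact h₀ 1

section

variable (X : SSSet.{u}) [IsSegalSpace X]

lemma exists_filler {x y z : (X _⦋0⦌) _⦋0⦌} (f : (mapSpace X ![x, y] : SSet.{u}) _⦋0⦌)
    (g : (mapSpace X ![y, z] : SSet.{u}) _⦋0⦌) :
    ∃ s : (mapSpace X ![x, y, z] : SSet.{u}) _⦋0⦌,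
      (face₂ X x y z).app _ s = f ∧ (face₀ X x y z).app _ s = g := by
  obtain ⟨s, hs⟩ := IsSegalSpace.exists_vertex X (n := 2) (by omega) ![f.1, g.1] (by
    intro i j hij
    obtain ⟨rfl, rfl⟩ : i = 0 ∧ j = 1 := by omega
    exact (of_mem f.2).2.trans (of_mem g.2).1.symm)
  have h0 := hs 0
  have h1 := hs 1
  rw [prinEdge_two_zero] at h0
  rw [prinEdge_two_one] at h1
  change (X.δ 2).app _ s = f.1 at h0
  change (X.δ 0).app _ s = g.1 at h1
  exact ⟨⟨s, mem_of_faces s (h0 ▸ f.2) (h1 ▸ g.2)⟩, Subtype.ext h0, Subtype.ext h1⟩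

lemma eq_of_edges {x y z : (X _⦋0⦌) _⦋0⦌} (s s' : (mapSpace X ![x, y, z] : SSet.{u}) _⦋0⦌)
    (a : Edge ((face₂ X x y z).app _ s) ((face₂ X x y z).app _ s'))
    (b : Edge ((face₀ X x y z).app _ s) ((face₀ X x y z).app _ s')) :
    π₀.mk s = π₀.mk s' := by
  obtain ⟨t, ht, ht', hs⟩ := IsSegalSpace.exists_edge X (n := 2) (by omega) ![a.edge.1, b.edge.1] (by
    intro i j hij
    obtain ⟨rfl, rfl⟩ : i = 0 ∧ j = 1 := by omega
    exact (of_mem a.edge.2).2.trans (of_mem b.edge.2).1.symm) s.1 s'.1 (by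
      intro i
      fin_cases i
      · change (X.map (prinEdge 0).op).app _ s.1 = _
        rw [prinEdge_two_zero]
        exact (congrArg Subtype.val a.src_eq).symm
      · change (X.map (prinEdge 1).op).app _ s.1 = _
        rw [prinEdge_two_one]
        exact (congrArg Subtype.val b.src_eq).symm) (by
      intro i
      fin_cases i
      · change (X.map (prinEdge 0).op).app _ s'.1 = _
        rw [prinEdge_two_zero]
        exact (congrArg Subtype.val a.tgt_eq).symm
      · change (X.map (prinEdge 1).op).app _ s'.1 = _
        rw [prinEdge_two_one]
        exact (congrArg Subtype.val b.tgt_eq).symm)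
  have h0 := hs 0
  have h1 := hs 1
  rw [prinEdge_two_zero] at h0
  rw [prinEdge_two_one] at h1
  change (X.δ 2).app _ t = a.edge.1 at h0
  change (X.δ 0).app _ t = b.edge.1 at h1
  exact π₀.sound (Edge.mk (X := (mapSpace X ![x, y, z] : SSet.{u}))
    ⟨t, mem_of_faces t (h0 ▸ a.edge.2) (h1 ▸ b.edge.2)⟩
    (Subtype.ext ht) (Subtype.ext ht'))

/-- `π₀ X(x, y, z) → π₀ X(x, y) × π₀ X(y, z)` is bijective. -/
lemma bijective_segal (x y z : (X _⦋0⦌) _⦋0⦌) :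
    Function.Bijective (fun c : π₀ (mapSpace X ![x, y, z] : SSet.{u}) =>
      ((mapπ₀ (face₂ X x y z) c, mapπ₀ (face₀ X x y z) c) : Hom X x y × Hom X y z)) := by
  choose s hs hs' using fun f g => exists_filler X (x := x) (y := y) (z := z) f g
  have h (f f' g g') (a : Edge f f') (b : Edge g g') : π₀.mk (s f g) = π₀.mk (s f' g') :=
    eq_of_edges X _ _ ((Edge.mk a.edge (a.src_eq.trans (hs f g).symm) (a.tgt_eq.trans (hs f' g').symm)))
      ((Edge.mk b.edge (b.src_eq.trans (hs' f g).symm) (b.tgt_eq.trans (hs' f' g').symm)))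
  let inv : Hom X x y × Hom X y z → π₀ (mapSpace X ![x, y, z] : SSet.{u}) := fun p =>
    π₀.lift (fun f => π₀.lift (fun g => π₀.mk (s f g)) (fun g g' b => h _ _ _ _ (Edge.id f) b) p.2)
      (fun f f' a => by
        obtain ⟨p, q⟩ := p
        obtain ⟨g, rfl⟩ := π₀.mk_surjective q
        exact h _ _ _ _ a (Edge.id g)) p.1
  constructor
  · apply Function.LeftInverse.injective (g := inv)
    intro c
    obtain ⟨t, rfl⟩ := π₀.mk_surjective c
    exact eq_of_edges X _ _
      (Edge.mk (Edge.id ((face₂ X x y z).app _ t)).edge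
        ((Edge.id _).src_eq.trans (hs _ _).symm) (Edge.id _).tgt_eq)
      (Edge.mk (Edge.id ((face₀ X x y z).app _ t)).edge
        ((Edge.id _).src_eq.trans (hs' _ _).symm) (Edge.id _).tgt_eq)
  · rintro ⟨p, q⟩
    obtain ⟨f, rfl⟩ := π₀.mk_surjective p
    obtain ⟨g, rfl⟩ := π₀.mk_surjective q
    exact ⟨π₀.mk (s f g), Prod.ext (congrArg π₀.mk (hs f g)) (congrArg π₀.mk (hs' f g))⟩

/-- Composition: the map `π₀ X(x, y) × π₀ X(y, z) → π₀ X(x, z)` obtained from the face operator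
`d₁ : X(x, y, z) ⟶ X(x, z)` and the bijection `π₀ X(x, y, z) ≃ π₀ X(x, y) × π₀ X(y, z)`. -/
noncomputable def comp {x y z : (X _⦋0⦌) _⦋0⦌} (f : Hom X x y) (g : Hom X y z) : Hom X x z :=
  mapπ₀ (face₁ X x y z) ((Equiv.ofBijective _ (bijective_segal X x y z)).symm (f, g))

lemma comp_faces {x y z : (X _⦋0⦌) _⦋0⦌} (s : (mapSpace X ![x, y, z] : SSet.{u}) _⦋0⦌) :
    comp X (π₀.mk ((face₂ X x y z).app _ s)) (π₀.mk ((face₀ X x y z).app _ s)) =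
      π₀.mk ((face₁ X x y z).app _ s) := by
  have : (Equiv.ofBijective _ (bijective_segal X x y z)).symm
      (π₀.mk ((face₂ X x y z).app _ s), π₀.mk ((face₀ X x y z).app _ s)) = π₀.mk s := by
    rw [Equiv.symm_apply_eq]
    rfl
  rw [comp, this]
  rfl

lemma comp_mk {x y z : (X _⦋0⦌) _⦋0⦌} (f : (mapSpace X ![x, y] : SSet.{u}) _⦋0⦌)
    (g : (mapSpace X ![y, z] : SSet.{u}) _⦋0⦌) (k : (mapSpace X ![x, z] : SSet.{u}) _⦋0⦌)
    (s : (X _⦋2⦌) _⦋0⦌) (h₂ : (X.δ 2).app _ s = f.1) (h₀ : (X.δ 0).app _ s = g.1)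
    (h₁ : (X.δ 1).app _ s = k.1) :
    comp X (π₀.mk f) (π₀.mk g) = π₀.mk k := by
  let t : (mapSpace X ![x, y, z] : SSet.{u}) _⦋0⦌ := ⟨s, mem_of_faces s (h₂ ▸ f.2) (h₀ ▸ g.2)⟩
  have e₂ : (face₂ X x y z).app _ t = f := Subtype.ext h₂
  have e₀ : (face₀ X x y z).app _ t = g := Subtype.ext h₀
  have e₁ : (face₁ X x y z).app _ t = k := Subtype.ext h₁
  rw [← e₂, ← e₀, ← e₁]
  exact comp_faces X t

lemma id_comp {x y : (X _⦋0⦌) _⦋0⦌} (f : Hom X x y) : comp X (id X x) f = f := by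
  obtain ⟨f, rfl⟩ := π₀.mk_surjective f
  have hf := (of_mem f.2).1.trans (map_const_zero (n := 0) x)
  apply comp_mk X _ _ _ ((X.σ 0).app _ f.1)
  · rw [← NatTrans.comp_app_apply, SimplicialObject.δ_comp_σ_of_gt' _ (by decide)]
    exact congrArg ((X.σ 0).app _) hf
  · rw [← NatTrans.comp_app_apply, SimplicialObject.δ_comp_σ_self' _ (by rfl)]
    rfl
  · rw [← NatTrans.comp_app_apply, SimplicialObject.δ_comp_σ_succ' _ (by rfl)]
    rfl

lemma comp_id {x y : (X _⦋0⦌) _⦋0⦌} (f : Hom X x y) : comp X f (id X y) = f := by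
  obtain ⟨f, rfl⟩ := π₀.mk_surjective f
  have hf := (of_mem f.2).2.trans (map_const_zero (n := 0) y)
  apply comp_mk X _ _ _ ((X.σ 1).app _ f.1)
  · rw [← NatTrans.comp_app_apply, SimplicialObject.δ_comp_σ_succ' _ (by rfl)]
    rfl
  · rw [← NatTrans.comp_app_apply]
    have : X.σ (1 : Fin 2) ≫ X.δ 0 = X.δ 0 ≫ X.σ 0 := X.δ_comp_σ_of_le (n := 0) (i := 0) (j := 0) le_rfl
    rw [this]
    exact congrArg ((X.σ 0).app _) hf
  · rw [← NatTrans.comp_app_apply, SimplicialObject.δ_comp_σ_self' _ (by rfl)]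
    rfl

lemma assoc {w x y z : (X _⦋0⦌) _⦋0⦌} (f : Hom X w x) (g : Hom X x y) (h : Hom X y z) :
    comp X (comp X f g) h = comp X f (comp X g h) := by
  obtain ⟨f, rfl⟩ := π₀.mk_surjective f
  obtain ⟨g, rfl⟩ := π₀.mk_surjective g
  obtain ⟨h, rfl⟩ := π₀.mk_surjective h
  obtain ⟨r, hr⟩ := IsSegalSpace.exists_vertex X (n := 3) (by omega) ![f.1, g.1, h.1] (by
    intro i j hij
    obtain ⟨rfl, rfl⟩ | ⟨rfl, rfl⟩ : (i = 0 ∧ j = 1) ∨ (i = 1 ∧ j = 2) := by omega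
    · exact (of_mem f.2).2.trans (of_mem g.2).1.symm
    · exact (of_mem g.2).2.trans (of_mem h.2).1.symm)
  have key (j : Fin 3) (k : Fin 4) (θ : ⦋1⦌ ⟶ ⦋3⦌) (hθ : θ = SimplexCategory.δ j ≫ SimplexCategory.δ k) :
      (X.δ j).app _ ((X.δ k).app _ r) = (X.map θ.op).app _ r := by
    rw [hθ, op_comp, X.map_comp]
    rfl
  have a0 := hr 0
  have a1 := hr 1
  have a2 := hr 2
  have f3 := (key 2 3 (prinEdge 0) (by ext k; fin_cases k <;> rfl)).trans a0
  have g3 := (key 0 3 (prinEdge 1) (by ext k; fin_cases k <;> rfl)).trans a1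
  have f2 := (key 2 2 (prinEdge 0) (by ext k; fin_cases k <;> rfl)).trans a0
  have g0 := (key 2 0 (prinEdge 1) (by ext k; fin_cases k <;> rfl)).trans a1
  have h0 := (key 0 0 (prinEdge 2) (by ext k; fin_cases k <;> rfl)).trans a2
  have h1 := (key 0 1 (prinEdge 2) (by ext k; fin_cases k <;> rfl)).trans a2
  have fg := (key 1 3 _ rfl).trans (key 2 1 _ (by ext k; fin_cases k <;> rfl)).symm
  have gh := (key 1 0 _ rfl).trans (key 0 2 _ (by ext k; fin_cases k <;> rfl)).symm
  have fgh := (key 1 1 _ rfl).trans (key 1 2 _ (by ext k; fin_cases k <;> rfl)).symm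
  let t₃ : (mapSpace X ![w, x, y] : SSet.{u}) _⦋0⦌ :=
    ⟨(X.δ 3).app _ r, mem_of_faces _ (f3 ▸ f.2) (g3 ▸ g.2)⟩
  let t₀ : (mapSpace X ![x, y, z] : SSet.{u}) _⦋0⦌ :=
    ⟨(X.δ 0).app _ r, mem_of_faces _ (g0 ▸ g.2) (h0 ▸ h.2)⟩
  let p := (face₁ X w x y).app _ t₃
  let q := (face₁ X x y z).app _ t₀
  have hp : p.1 = (X.δ 1).app _ ((X.δ 3).app _ r) := rfl
  have hq : q.1 = (X.δ 1).app _ ((X.δ 0).app _ r) := rfl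
  let t₁ : (mapSpace X ![w, y, z] : SSet.{u}) _⦋0⦌ :=
    ⟨(X.δ 1).app _ r, mem_of_faces _ ((hp.trans fg) ▸ p.2) (h1 ▸ h.2)⟩
  let k := (face₁ X w y z).app _ t₁
  rw [comp_mk X f g p _ f3 g3 rfl, comp_mk X g h q _ g0 h0 rfl,
    comp_mk X p h k _ (hp.trans fg).symm h1 rfl, comp_mk X f q k _ f2 (hq.trans gh).symm fgh.symm]

end

/-- The category structure on the homotopy category of a Segal space. -/
noncomputable instance category (X : SSSet.{u}) [IsSegalSpace X] : SmallCategory.{u} (Ho X) where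
  Hom x y := Hom X x y
  id x := id X x
  comp f g := comp X f g
  id_comp f := id_comp X f
  comp_id f := comp_id X f
  assoc f g h := assoc X f g h

end Ho

namespace ClassifyingDiagram

/-- The category `[n] × I[m]`, where `I[m]` is the groupoid obtained by freely inverting all morphisms
of `[m]`. -/
abbrev Shape (n m : SimplexCategory) : Type :=
  Fin (n.len + 1) × FreeGroupoid (Fin (m.len + 1))

/-- The functor `[n] × I[m] ⥤ [n'] × I[m']` induced by `θ : [n] ⟶ [n']` and `φ : [m] ⟶ [m']`. -/
abbrev Shape.map {n n' m m' : SimplexCategory} (θ : n ⟶ n') (φ : m ⟶ m') :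
    Shape n m ⥤ Shape n' m' :=
  (OrderHom.monotone (SimplexCategory.Hom.toOrderHom θ)).functor.prod
    (FreeGroupoid.map (OrderHom.monotone (SimplexCategory.Hom.toOrderHom φ)).functor)

lemma Shape.map_id (n m : SimplexCategory) : Shape.map (𝟙 n) (𝟙 m) = 𝟭 _ := by
  have h : FreeGroupoid.map (OrderHom.monotone (SimplexCategory.Hom.toOrderHom (𝟙 m))).functor = 𝟭 _ :=
    FreeGroupoid.map_id _
  unfold Shape.map
  rw [h]
  rfl

lemma Shape.map_comp {n n' n'' m m' m'' : SimplexCategory} (θ : n ⟶ n') (φ : m ⟶ m')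
    (θ' : n' ⟶ n'') (φ' : m' ⟶ m'') :
    Shape.map (θ ≫ θ') (φ ≫ φ') = Shape.map θ φ ⋙ Shape.map θ' φ' := by
  have h : FreeGroupoid.map (OrderHom.monotone (SimplexCategory.Hom.toOrderHom (φ ≫ φ'))).functor =
      FreeGroupoid.map (OrderHom.monotone (SimplexCategory.Hom.toOrderHom φ)).functor ⋙
      FreeGroupoid.map (OrderHom.monotone (SimplexCategory.Hom.toOrderHom φ')).functor :=
    FreeGroupoid.map_comp (OrderHom.monotone (SimplexCategory.Hom.toOrderHom φ)).functor
      (OrderHom.monotone (SimplexCategory.Hom.toOrderHom φ')).functor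
  unfold Shape.map
  rw [h]
  rfl

end ClassifyingDiagram

/-- The functor sending a small category `C` to its classifying diagram, the bisimplicial set `N C` with
`(N C)_{n,m}` the set of functors `[n] × I[m] ⥤ C`. Simplicial operators act by precomposition, and
functors `C ⥤ D` act by postcomposition. -/
def N : Cat.{u, u} ⥤ SSSet.{u} where
  obj C :=
    { obj n :=
        { obj m := ClassifyingDiagram.Shape n.unop m.unop ⥤ C
          map φ := ↾fun F => ClassifyingDiagram.Shape.map (𝟙 _) φ.unop ⋙ F
          map_id m := by
            ext F
            exact congrArg (· ⋙ F) (ClassifyingDiagram.Shape.map_id _ _)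
          map_comp φ ψ := by
            ext F
            exact congrArg (· ⋙ F) (ClassifyingDiagram.Shape.map_comp (𝟙 _) ψ.unop (𝟙 _) φ.unop) }
      map θ :=
        { app m := ↾fun F => ClassifyingDiagram.Shape.map θ.unop (𝟙 _) ⋙ F
          naturality m m' φ := by
            ext F
            have h1 := ClassifyingDiagram.Shape.map_comp θ.unop (𝟙 _) (𝟙 _) φ.unop
            have h2 := ClassifyingDiagram.Shape.map_comp (𝟙 _) φ.unop θ.unop (𝟙 _)
            rw [Category.comp_id, Category.id_comp] at h1 h2
            exact congrArg (· ⋙ F) (h1.symm.trans h2) }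
      map_id n := by
        ext m F
        exact congrArg (· ⋙ F) (ClassifyingDiagram.Shape.map_id _ _)
      map_comp θ η := by
        ext m F
        exact congrArg (· ⋙ F) (ClassifyingDiagram.Shape.map_comp η.unop (𝟙 _) θ.unop (𝟙 _)) }
  map G :=
    { app n := { app m := ↾fun F => F ⋙ G.toFunctor
                 naturality _ _ _ := rfl }
      naturality _ _ _ := rfl }
  map_id _ := rfl
  map_comp _ _ := rfl

namespace ClassifyingDiagram

/-- The categories `[n] × I[m]` as small categories in the universe `u`. -/
def smallShape : SimplexCategory × SimplexCategory ⥤ Cat.{u, u} where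
  obj p := Cat.of (AsSmall.{u} (Shape p.1 p.2))
  map f := (AsSmall.down ⋙ Shape.map f.1 f.2 ⋙ AsSmall.up).toCatHom
  map_id p := congrArg (fun F => (AsSmall.down ⋙ F ⋙ AsSmall.up).toCatHom) (Shape.map_id p.1 p.2)
  map_comp f g := congrArg (fun F => (AsSmall.down ⋙ F ⋙ AsSmall.up).toCatHom)
    (Shape.map_comp f.1 f.2 g.1 g.2)

/-- Currying: presheaves on the product of the simplex category with itself are bisimplicial sets. -/
noncomputable def bisimplicialEquiv : ((SimplexCategory × SimplexCategory)ᵒᵖ ⥤ Type u) ≌ SSSet.{u} :=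
  (prodOpEquiv _).congrLeft.trans Functor.currying.symm

/-- The classifying diagram functor is the nerve functor associated to the categories `[n] × I[m]`. -/
noncomputable def isoN : Presheaf.restrictedULiftYoneda.{u} smallShape.{u} ⋙ bisimplicialEquiv.functor ≅ N.{u} :=
  NatIso.ofComponents (fun _ =>
    NatIso.ofComponents (fun _ =>
      NatIso.ofComponents (fun _ =>
        Equiv.toIso
          { toFun F := AsSmall.up ⋙ F.down.toFunctor
            invFun F := ⟨(AsSmall.down ⋙ F).toCatHom⟩
            left_inv _ := rfl
            right_inv _ := rfl })
        (fun _ => rfl))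
      (fun _ => rfl))
    (fun _ => rfl)

end ClassifyingDiagram

/-- The classifying diagram functor has a left adjoint. -/
instance N_isRightAdjoint : N.{u}.IsRightAdjoint := by
  have : Limits.HasColimitsOfSize.{0, u} Cat.{u, u} := Limits.hasColimitsOfSizeShrink.{0, u, u, u} Cat.{u, u}
  have : (Presheaf.restrictedULiftYoneda.{u} ClassifyingDiagram.smallShape.{u}).IsRightAdjoint :=
    ⟨_, ⟨Presheaf.uliftYonedaAdjunction.{u} (uliftYoneda.{u}.leftKanExtension _) (uliftYoneda.{u}.leftKanExtensionUnit _)⟩⟩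
  have : ClassifyingDiagram.bisimplicialEquiv.{u}.functor.IsRightAdjoint :=
    ClassifyingDiagram.bisimplicialEquiv.isRightAdjoint_functor
  exact Functor.isRightAdjoint_of_iso ClassifyingDiagram.isoN

/-- The fundamental category functor: the left adjoint of the classifying diagram functor. -/
noncomputable def τ₁ : SSSet.{u} ⥤ Cat.{u, u} := N.leftAdjoint

/-- The adjunction between the fundamental category and the classifying diagram. -/
noncomputable def τ₁Adjunction : τ₁.{u} ⊣ N.{u} := Adjunction.ofIsRightAdjoint N

end SegalSpaces

/-!
Morphisms `X ⟶ N C` from a Segal space `X` are the same as functors `Ho X ⥤ C`. The reason is that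
there is a canonical morphism `Ho.unit X : X ⟶ N (Ho X)` through which every `F : X ⟶ N C` factors
as `unit X ≫ N.map (Ho.desc F)` for exactly one functor `Ho.desc F : Ho X ⥤ C`.

The substance lies in the construction of `unit X`, which needs a functor `[n] × I[m] ⥤ Ho X` for
each element of `X_{n,m}`. Horizontal edges represent morphisms of `Ho X` by definition; a
vertical edge, that is, a path `e : x ⤳ y` in the space of objects `X_{0,•}`, has to be turned
into an isomorphism `Ho.ver e : x ⟶ y`. Reedy fibrancy in degree one says that `X_{1,•} ⟶ X_{0,•}
× X_{0,•}` is a Kan fibration (`fibration_lift_δ`), and `ver e` is the class of the target of a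
lift, starting at the identity of `x`, of the pair formed by the constant path at `x` and `e`.
Everything then follows from the square relation `Ho.mk_comp_ver`: an element of `X_{1,1}` with
source `f`, target `f'` and sides `a`, `b` satisfies `[f] ≫ ver b = ver a ≫ [f']`. Indeed, the
Segal condition allows composing squares horizontally, and both composites are represented by
targets of lifts of the same pair of paths starting at `f`; such targets lie in the same component
of the fibre (`Ho.mk_target_eq`). Applied to suitable squares, this relation shows that `ver` is
functorial (`Ho.ver_comp_ver`) and takes values in isomorphisms (`Ho.isIso_ver`). A functor on
`[n] × I[m]` amounts to compatible horizontal morphisms and vertical isomorphisms, since `I[m]` is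
a free groupoid.

Conversely `F : X ⟶ N C` sends elements of `X_{1,0}` to morphisms of `C`, with homotopic elements
having the same image and triangles giving compositions; this is `desc F`. Evaluating `F` on the
square which defines `ver e` shows that the value of `F` on the path `e` is `desc F` of `ver e`
(`Ho.desc_map_ver`), so that `F` is determined by `desc F`. Finally, `τ₁ X` and `Ho X` corepresent
the same functor.
-/

namespace SegalSpaces

/-! ### Lifting along Kan fibrations -/

lemma exists_edge_lift_of_source {E B : SSet.{u}} (p : E ⟶ B) [Fibration p] (e : E _⦋0⦌)
    (b : B _⦋1⦌) (h : B.δ 1 b = p.app _ e) : ∃ a : E _⦋1⦌, p.app _ a = b ∧ E.δ 1 a = e := by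
  have hf : horn.IsCompatible (n := 0) (i := (0 : Fin 2))
      (fun _ _ => (SSet.yonedaEquiv.symm e : Δ[0] ⟶ E)) := trivial
  obtain ⟨φ, h1, h2⟩ := hf.exists_lift p (SSet.yonedaEquiv.symm b) (by
    intro j hj
    obtain rfl : j = 1 := by revert j; decide
    rw [stdSimplex.δ_comp_yonedaEquiv_symm, h, SSet.yonedaEquiv_symm_comp])
  refine ⟨SSet.yonedaEquiv φ, ?_, ?_⟩
  · rw [← SSet.yonedaEquiv_comp, h2, Equiv.apply_symm_apply]
  · rw [← stdSimplex.yonedaEquiv_δ_comp, h1 1 (by simp), Equiv.apply_symm_apply]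

/-- Given two edges of `E` with the same source lying over the edges `t₀₁` and `t₀₂` of a triangle
`t` of `B`, there is an edge between their targets lying over `t₁₂`: lift `t` along the horn they
form. -/
lemma exists_edge_lift_of_horn {E B : SSet.{u}} (p : E ⟶ B) [Fibration p] (a a' : E _⦋1⦌)
    (t : B _⦋2⦌) (haa' : E.δ 1 a = E.δ 1 a') (ha : p.app _ a = B.δ 2 t)
    (ha' : p.app _ a' = B.δ 1 t) :
    ∃ c : E _⦋1⦌, p.app _ c = B.δ 0 t ∧ E.δ 1 c = E.δ 0 a ∧ E.δ 0 c = E.δ 0 a' := by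
  let f : ∀ (j : Fin 3) (_ : j ≠ 0), Δ[1] ⟶ E := fun j _ =>
    if j = 1 then SSet.yonedaEquiv.symm a' else SSet.yonedaEquiv.symm a
  have hf : horn.IsCompatible (i := (0 : Fin 3)) f := by
    rw [horn.isCompatible_iff]
    intro j k hj hk hjk
    obtain ⟨rfl, rfl⟩ : j = 1 ∧ k = 2 := by
      revert j k; decide
    change stdSimplex.δ (1 : Fin 2) ≫ SSet.yonedaEquiv.symm a' =
      stdSimplex.δ (1 : Fin 2) ≫ SSet.yonedaEquiv.symm a
    rw [stdSimplex.δ_comp_yonedaEquiv_symm, stdSimplex.δ_comp_yonedaEquiv_symm, haa']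
  obtain ⟨φ, h1, h2⟩ := hf.exists_lift p (SSet.yonedaEquiv.symm t) (by
    intro j hj
    have : j = 1 ∨ j = 2 := by revert j; decide
    rcases this with rfl | rfl
    · change SSet.yonedaEquiv.symm a' ≫ p = _
      rw [stdSimplex.δ_comp_yonedaEquiv_symm, SSet.yonedaEquiv_symm_comp, ha']
    · change SSet.yonedaEquiv.symm a ≫ p = _
      rw [stdSimplex.δ_comp_yonedaEquiv_symm, SSet.yonedaEquiv_symm_comp, ha])
  have e1 : E.δ 1 (SSet.yonedaEquiv φ) = a' := by
    rw [← stdSimplex.yonedaEquiv_δ_comp, h1 1 (by simp)]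
    exact Equiv.apply_symm_apply _ _
  have e2 : E.δ 2 (SSet.yonedaEquiv φ) = a := by
    rw [← stdSimplex.yonedaEquiv_δ_comp, h1 2 (by simp)]
    exact Equiv.apply_symm_apply _ _
  refine ⟨E.δ 0 (SSet.yonedaEquiv φ), ?_, ?_, ?_⟩
  · have h3 : p.app _ (SSet.yonedaEquiv φ) = t := by
      rw [← SSet.yonedaEquiv_comp, h2, Equiv.apply_symm_apply]
    rw [← h3]
    exact NatTrans.naturality_apply p (SimplexCategory.δ 0).op _
  · rw [← e2]
    exact (ConcreteCategory.congr_hom (E.δ_comp_δ (n := 0) (i := 0) (j := 1) (by decide)) _).symm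
  · rw [← e1]
    exact (ConcreteCategory.congr_hom (E.δ_comp_δ (n := 0) (i := 0) (j := 0) (by decide)) _).symm

/-- The `n`-th column of `X` is `M_v(Δ[n], X)`. -/
def Mv.columnIso (X : SSSet.{u}) (n : ℕ) : Mv Δ[n] X ≅ X _⦋n⦌ :=
  NatIso.ofComponents
    (fun m => (SSet.yonedaEquiv (X := X.flip.obj m) (n := ⦋n⦌)).toIso)
    (fun _ => rfl)

/-- The morphism `M_v(∂Δ[1], X) ⟶ X_{0,•} × X_{0,•}` evaluating at the vertices `0`, `1`. -/
def Mv.boundaryEval (X : SSSet.{u}) : Mv ∂Δ[1] X ⟶ X _⦋0⦌ ⊗ X _⦋0⦌ :=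
  lift (Mv.map (boundary.ι 1) X ≫ (Mv.columnIso X 0).hom)
    (Mv.map (boundary.ι 0) X ≫ (Mv.columnIso X 0).hom)

lemma isIso_boundaryEval (X : SSSet.{u}) : IsIso (Mv.boundaryEval X) := by
  rw [NatTrans.isIso_iff_isIso_app]
  intro m
  rw [isIso_iff_bijective]
  constructor
  · intro (g : _ ⟶ X.flip.obj m) (h : _ ⟶ X.flip.obj m) hgh
    apply boundary.hom_ext
    rw [Fin.forall_fin_two]
    exact ⟨SSet.yonedaEquiv.injective (congrArg Prod.snd hgh),
      SSet.yonedaEquiv.injective (congrArg Prod.fst hgh)⟩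
  · rintro ⟨a, b⟩
    obtain ⟨g, h1, h0⟩ := exists_boundary_desc (W := X.flip.obj m) a b
    refine ⟨g, Prod.ext ?_ ?_⟩
    · exact (congrArg SSet.yonedaEquiv h1).trans (Equiv.apply_symm_apply _ _)
    · exact (congrArg SSet.yonedaEquiv h0).trans (Equiv.apply_symm_apply _ _)

lemma map_boundary_comp_boundaryEval (X : SSSet.{u}) :
    Mv.map ∂Δ[1].ι X ≫ Mv.boundaryEval X = (Mv.columnIso X 1).hom ≫ lift (X.δ 1) (X.δ 0) := by
  apply NatTrans.ext
  funext m
  ext (g : Δ[1] ⟶ X.flip.obj m)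
  refine Prod.ext ?_ ?_
  · exact (SSet.yonedaEquiv_naturality (SimplexCategory.δ 1) g).symm
  · exact (SSet.yonedaEquiv_naturality (SimplexCategory.δ 0) g).symm

section

variable (X : SSSet.{u}) [IsSegalSpace X]

/-- The source and target morphism `X_{1,•} ⟶ X_{0,•} × X_{0,•}` of a Segal space is a Kan
fibration: it is the matching morphism of Reedy fibrancy in degree one. -/
instance fibration_lift_δ : Fibration (lift (X.δ 1) (X.δ 0) : X _⦋1⦌ ⟶ X _⦋0⦌ ⊗ X _⦋0⦌) := by
  have := IsSegalSpace.reedyFibrant (X := X) 1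
  rw [HomotopicalAlgebra.fibration_iff] at this ⊢
  refine (MorphismProperty.arrow_mk_iso_iff _ (Arrow.isoMk (Mv.columnIso X 1)
    (@asIso _ _ _ _ (Mv.boundaryEval X) (isIso_boundaryEval X)) ?_)).1 this
  exact (map_boundary_comp_boundaryEval X).symm

/-- The Kan fibration `X_{1,•} ⟶ X_{0,•} × X_{0,•}` lifts pairs of edges starting at a
given vertex. -/
lemma exists_square_of_source (f : (X _⦋1⦌) _⦋0⦌) (a b : (X _⦋0⦌) _⦋1⦌)
    (ha : (X _⦋0⦌).δ 1 a = (X.δ 1).app _ f) (hb : (X _⦋0⦌).δ 1 b = (X.δ 0).app _ f) :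
    ∃ α : (X _⦋1⦌) _⦋1⦌, (X.δ 1).app _ α = a ∧ (X.δ 0).app _ α = b ∧ (X _⦋1⦌).δ 1 α = f := by
  obtain ⟨α, h1, h2⟩ := exists_edge_lift_of_source (lift (X.δ 1) (X.δ 0) : X _⦋1⦌ ⟶ X _⦋0⦌ ⊗ X _⦋0⦌)
    f (a, b) (Prod.ext ha hb)
  exact ⟨α, congrArg Prod.fst h1, congrArg Prod.snd h1, h2⟩

/-- Two squares with the same source arrow, lying over pairs of edges `t₀₁`, `t₀₂` of triangles in
`X_{0,•}`, are related by a square over the edges `t₁₂`. -/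
lemma exists_square_of_horn (α β : (X _⦋1⦌) _⦋1⦌) (t t' : (X _⦋0⦌) _⦋2⦌)
    (h : (X _⦋1⦌).δ 1 α = (X _⦋1⦌).δ 1 β)
    (hα : (X.δ 1).app _ α = (X _⦋0⦌).δ 2 t) (hα' : (X.δ 0).app _ α = (X _⦋0⦌).δ 2 t')
    (hβ : (X.δ 1).app _ β = (X _⦋0⦌).δ 1 t) (hβ' : (X.δ 0).app _ β = (X _⦋0⦌).δ 1 t') :
    ∃ γ : (X _⦋1⦌) _⦋1⦌, (X.δ 1).app _ γ = (X _⦋0⦌).δ 0 t ∧ (X.δ 0).app _ γ = (X _⦋0⦌).δ 0 t' ∧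
      (X _⦋1⦌).δ 1 γ = (X _⦋1⦌).δ 0 α ∧ (X _⦋1⦌).δ 0 γ = (X _⦋1⦌).δ 0 β := by
  obtain ⟨γ, h1, h2, h3⟩ := exists_edge_lift_of_horn
    (lift (X.δ 1) (X.δ 0) : X _⦋1⦌ ⟶ X _⦋0⦌ ⊗ X _⦋0⦌) α β (t, t') h
    (Prod.ext hα hα') (Prod.ext hβ hβ')
  exact ⟨γ, congrArg Prod.fst h1, congrArg Prod.snd h1, h2, h3⟩

end

/-! ### Simplicial identities for elements of bisimplicial sets -/

lemma map_app_map_app (X : SSSet.{u}) {n n' n'' : SimplexCategory} {θ : n ⟶ n'} {θ' : n' ⟶ n''}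
    {ψ : n ⟶ n''} (h : θ ≫ θ' = ψ) {m : SimplexCategoryᵒᵖ} (s : (X.obj (op n'')).obj m) :
    (X.map θ.op).app m ((X.map θ'.op).app m s) = (X.map ψ.op).app m s := by
  rw [← h, op_comp, X.map_comp]
  rfl

lemma map_app_id (X : SSSet.{u}) {n : SimplexCategory} {θ : n ⟶ n} (h : θ = 𝟙 n)
    {m : SimplexCategoryᵒᵖ} (s : (X.obj (op n)).obj m) : (X.map θ.op).app m s = s := by
  rw [h, op_id, X.map_id]
  rfl

lemma map_map_of_comp (A : SSet.{u}) {n n' n'' : SimplexCategory} {θ : n ⟶ n'} {θ' : n' ⟶ n''}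
    {ψ : n ⟶ n''} (h : θ ≫ θ' = ψ) (s : A.obj (op n'')) :
    A.map θ.op (A.map θ'.op s) = A.map ψ.op s := by
  rw [← h, op_comp, Functor.map_comp_apply]

lemma map_of_eq_id (A : SSet.{u}) {n : SimplexCategory} {θ : n ⟶ n} (h : θ = 𝟙 n)
    (s : A.obj (op n)) : A.map θ.op s = s := by
  rw [h, op_id, Functor.map_id_apply]

section

variable (A : SSet.{u})

lemma δ_σ_vertex (x : A _⦋0⦌) (i : Fin 2) : A.δ i (A.σ 0 x) = x :=
  (map_map_of_comp A (Subsingleton.elim _ (𝟙 _)) x).trans (map_of_eq_id A rfl x)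

lemma δ_castSucc_σ (e : A _⦋1⦌) (i : Fin 2) : A.δ i.castSucc (A.σ i e) = e :=
  (map_map_of_comp A SimplexCategory.δ_comp_σ_self e).trans (map_of_eq_id A rfl e)

lemma δ_succ_σ (e : A _⦋1⦌) (i : Fin 2) : A.δ i.succ (A.σ i e) = e :=
  (map_map_of_comp A SimplexCategory.δ_comp_σ_succ e).trans (map_of_eq_id A rfl e)

lemma δ_zero_σ_one (e : A _⦋1⦌) : A.δ 0 (A.σ 1 e) = A.σ 0 (A.δ 0 e) :=
  (map_map_of_comp A (SimplexCategory.δ_comp_σ_of_le (i := (0 : Fin 2)) (j := (0 : Fin 1))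
    (by decide)) e).trans (map_map_of_comp A rfl e).symm

lemma δ_two_σ_zero (e : A _⦋1⦌) : A.δ 2 (A.σ 0 e) = A.σ 0 (A.δ 1 e) :=
  (map_map_of_comp A (SimplexCategory.δ_comp_σ_of_gt (i := (1 : Fin 2)) (j := (0 : Fin 1))
    (by decide)) e).trans (map_map_of_comp A rfl e).symm

end

lemma app_δ {A B : SSet.{u}} (f : A ⟶ B) {n : ℕ} (i : Fin (n + 2)) (a : A _⦋n + 1⦌) :
    f.app _ (A.δ i a) = B.δ i (f.app _ a) :=
  NatTrans.naturality_apply f (SimplexCategory.δ i).op a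

lemma app_σ {A B : SSet.{u}} (f : A ⟶ B) {n : ℕ} (i : Fin (n + 1)) (a : A _⦋n⦌) :
    f.app _ (A.σ i a) = B.σ i (f.app _ a) :=
  NatTrans.naturality_apply f (SimplexCategory.σ i).op a

lemma δ_app_σ_app (X : SSSet.{u}) {m : ℕ} (x : (X _⦋0⦌) _⦋m⦌) (i : Fin 2) :
    (X.δ i).app _ ((X.σ 0).app _ x) = x :=
  δ_σ_vertex (X.flip.obj (op ⦋m⦌)) x i

namespace Ho

/-! ### The square relation in the homotopy category -/

/-- The morphism of the homotopy category represented by an element of `X_{1,0}` with prescribed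
source and target. -/
def mk {X : SSSet.{u}} [IsSegalSpace X] {x y : Ho X} (f : (X _⦋1⦌) _⦋0⦌)
    (h₁ : (X.δ 1).app _ f = x) (h₀ : (X.δ 0).app _ f = y) : x ⟶ y :=
  π₀.mk (X := (mapSpace X ![(x : (X _⦋0⦌) _⦋0⦌), y] : SSet.{u})) ⟨f, mem_mapSpace f h₁ h₀⟩

variable {X : SSSet.{u}} [IsSegalSpace X]

lemma mk_surjective {x y : Ho X} (g : x ⟶ y) : ∃ f h₁ h₀, g = mk f h₁ h₀ := by
  obtain ⟨f, rfl⟩ := π₀.mk_surjective g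
  exact ⟨f.1, (of_mem f.2).1.trans (map_const_zero (n := 0) x),
    (of_mem f.2).2.trans (map_const_zero (n := 0) y), rfl⟩

lemma mk_comp_mk {x y z : Ho X} {f g k : (X _⦋1⦌) _⦋0⦌} (s : (X _⦋2⦌) _⦋0⦌)
    (h₂ : (X.δ 2).app _ s = f) (h₀ : (X.δ 0).app _ s = g) (h₁ : (X.δ 1).app _ s = k)
    (hf₁ : (X.δ 1).app _ f = x) (hf₀ : (X.δ 0).app _ f = y)
    (hg₁ : (X.δ 1).app _ g = y) (hg₀ : (X.δ 0).app _ g = z)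
    (hk₁ : (X.δ 1).app _ k = x) (hk₀ : (X.δ 0).app _ k = z) :
    mk f hf₁ hf₀ ≫ mk g hg₁ hg₀ = mk k hk₁ hk₀ :=
  comp_mk X _ _ _ s h₂ h₀ h₁

lemma mk_σ {x : Ho X} (h₁ : (X.δ 1).app _ ((X.σ 0).app _ x) = x)
    (h₀ : (X.δ 0).app _ ((X.σ 0).app _ x) = x) : mk ((X.σ 0).app _ x) h₁ h₀ = 𝟙 x := rfl

lemma mk_eq_of_square {x y : Ho X} {f g : (X _⦋1⦌) _⦋0⦌} (α : (X _⦋1⦌) _⦋1⦌)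
    (hx : (X.δ 1).app _ α = (X _⦋0⦌).σ 0 x) (hy : (X.δ 0).app _ α = (X _⦋0⦌).σ 0 y)
    (hf : (X _⦋1⦌).δ 1 α = f) (hg : (X _⦋1⦌).δ 0 α = g)
    (hf₁ : (X.δ 1).app _ f = x) (hf₀ : (X.δ 0).app _ f = y)
    (hg₁ : (X.δ 1).app _ g = x) (hg₀ : (X.δ 0).app _ g = y) :
    mk f hf₁ hf₀ = mk g hg₁ hg₀ := by
  have hα : α ∈ (mapSpace X ![(x : (X _⦋0⦌) _⦋0⦌), y]).obj (op ⦋1⦌) := by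
    intro i
    rw [const_δ]
    have : SimplexCategory.const ⦋1⦌ ⦋0⦌ 0 = SimplexCategory.σ 0 := Subsingleton.elim _ _
    dsimp only [unop_op]
    rw [this]
    fin_cases i
    · exact hx
    · exact hy
  exact π₀.sound (Edge.mk (X := (mapSpace X ![(x : (X _⦋0⦌) _⦋0⦌), y] : SSet.{u})) ⟨α, hα⟩
    (Subtype.ext hf) (Subtype.ext hg))

/-- Transport of an arrow along a pair of paths between its endpoints is well defined in the
homotopy category. -/
lemma mk_target_eq {x y : Ho X} {f g : (X _⦋1⦌) _⦋0⦌} (α β : (X _⦋1⦌) _⦋1⦌)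
    (h : (X _⦋1⦌).δ 1 α = (X _⦋1⦌).δ 1 β) (h₁ : (X.δ 1).app _ α = (X.δ 1).app _ β)
    (h₀ : (X.δ 0).app _ α = (X.δ 0).app _ β)
    (hf : (X _⦋1⦌).δ 0 α = f) (hg : (X _⦋1⦌).δ 0 β = g)
    (hf₁ : (X.δ 1).app _ f = x) (hf₀ : (X.δ 0).app _ f = y)
    (hg₁ : (X.δ 1).app _ g = x) (hg₀ : (X.δ 0).app _ g = y) :
    mk f hf₁ hf₀ = mk g hg₁ hg₀ := by
  -- The triangles in the base are degenerate, so that the third square has constant sides.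
  obtain ⟨γ, g1, g0, gs, gt⟩ := exists_square_of_horn X α β ((X _⦋0⦌).σ 1 ((X.δ 1).app _ α))
    ((X _⦋0⦌).σ 1 ((X.δ 0).app _ α)) h (δ_succ_σ _ _ 1).symm (δ_succ_σ _ _ 1).symm
    (h₁.symm.trans (δ_castSucc_σ _ _ 1).symm) (h₀.symm.trans (δ_castSucc_σ _ _ 1).symm)
  refine mk_eq_of_square γ ?_ ?_ (gs.trans hf) (gt.trans hg) _ _ _ _
  · rw [g1, δ_zero_σ_one, ← app_δ, hf, hf₁]
  · rw [g0, δ_zero_σ_one, ← app_δ, hf, hf₀]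

lemma exists_ver {x y : Ho X} (e : (X _⦋0⦌) _⦋1⦌) (h₁ : (X _⦋0⦌).δ 1 e = x)
    (h₀ : (X _⦋0⦌).δ 0 e = y) :
    ∃ α : (X _⦋1⦌) _⦋1⦌, ((X.δ 1).app _ α = (X _⦋0⦌).σ 0 x ∧ (X.δ 0).app _ α = e ∧
      (X _⦋1⦌).δ 1 α = (X.σ 0).app _ x) ∧ (X.δ 1).app _ ((X _⦋1⦌).δ 0 α) = x ∧
      (X.δ 0).app _ ((X _⦋1⦌).δ 0 α) = y := by
  obtain ⟨α, h⟩ := exists_square_of_source X ((X.σ 0).app _ x) ((X _⦋0⦌).σ 0 x) e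
    ((δ_σ_vertex _ _ 1).trans (δ_app_σ_app X _ _).symm) (h₁.trans (δ_app_σ_app X _ _).symm)
  refine ⟨α, h, ?_, ?_⟩
  · rw [app_δ, h.1]
    exact δ_σ_vertex _ _ _
  · rw [app_δ, h.2.1, h₀]

/-- The morphism of the homotopy category associated to a path `e` from `x` to `y` in the space of
objects: the target of a lift, starting at the identity of `x`, of the pair formed by the constant
path at `x` and `e`. The choice of the lift is immaterial, see `ver_eq`. -/
noncomputable def ver {x y : Ho X} (e : (X _⦋0⦌) _⦋1⦌) (h₁ : (X _⦋0⦌).δ 1 e = x)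
    (h₀ : (X _⦋0⦌).δ 0 e = y) : x ⟶ y :=
  mk ((X _⦋1⦌).δ 0 (exists_ver e h₁ h₀).choose) (exists_ver e h₁ h₀).choose_spec.2.1
    (exists_ver e h₁ h₀).choose_spec.2.2

lemma ver_eq {x y : Ho X} {e : (X _⦋0⦌) _⦋1⦌} (h₁ : (X _⦋0⦌).δ 1 e = x) (h₀ : (X _⦋0⦌).δ 0 e = y)
    {f : (X _⦋1⦌) _⦋0⦌} (α : (X _⦋1⦌) _⦋1⦌) (hx : (X.δ 1).app _ α = (X _⦋0⦌).σ 0 x)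
    (he : (X.δ 0).app _ α = e) (hs : (X _⦋1⦌).δ 1 α = (X.σ 0).app _ x) (hf : (X _⦋1⦌).δ 0 α = f)
    (hf₁ : (X.δ 1).app _ f = x) (hf₀ : (X.δ 0).app _ f = y) :
    ver e h₁ h₀ = mk f hf₁ hf₀ := by
  have h := (exists_ver e h₁ h₀).choose_spec.1
  exact mk_target_eq _ α (h.2.2.trans hs.symm) (h.1.trans hx.symm) (h.2.1.trans he.symm) rfl hf
    _ _ _ _

variable (X) in
lemma exists_triangle (f g : (X _⦋1⦌) _⦋0⦌) (h : (X.δ 0).app _ f = (X.δ 1).app _ g) :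
    ∃ s : (X _⦋2⦌) _⦋0⦌, (X.δ 2).app _ s = f ∧ (X.δ 0).app _ s = g := by
  obtain ⟨s, hs⟩ := IsSegalSpace.exists_vertex X (n := 2) (by omega) ![f, g] (by
    intro i j hij
    obtain ⟨rfl, rfl⟩ : i = 0 ∧ j = 1 := by omega
    exact h)
  have h0 := hs 0
  have h1 := hs 1
  rw [prinEdge_two_zero] at h0
  rw [prinEdge_two_one] at h1
  exact ⟨s, h0, h1⟩

/-- Horizontal composition of squares, with prescribed compositions of their sources and targets. -/
lemma exists_comp_square (α β : (X _⦋1⦌) _⦋1⦌) (h : (X.δ 0).app _ α = (X.δ 1).app _ β)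
    (s t : (X _⦋2⦌) _⦋0⦌)
    (hs₂ : (X.δ 2).app _ s = (X _⦋1⦌).δ 1 α) (hs₀ : (X.δ 0).app _ s = (X _⦋1⦌).δ 1 β)
    (ht₂ : (X.δ 2).app _ t = (X _⦋1⦌).δ 0 α) (ht₀ : (X.δ 0).app _ t = (X _⦋1⦌).δ 0 β) :
    ∃ γ : (X _⦋1⦌) _⦋1⦌, (X.δ 1).app _ γ = (X.δ 1).app _ α ∧ (X.δ 0).app _ γ = (X.δ 0).app _ β ∧
      (X _⦋1⦌).δ 1 γ = (X.δ 1).app _ s ∧ (X _⦋1⦌).δ 0 γ = (X.δ 1).app _ t := by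
  obtain ⟨r, r1, r0, hr⟩ := IsSegalSpace.exists_edge X (n := 2) (by omega) ![α, β] (by
      intro i j hij
      obtain ⟨rfl, rfl⟩ : i = 0 ∧ j = 1 := by omega
      exact h) s t (by
      rw [Fin.forall_fin_two, prinEdge_two_zero, prinEdge_two_one]
      exact ⟨hs₂, hs₀⟩) (by
      rw [Fin.forall_fin_two, prinEdge_two_zero, prinEdge_two_one]
      exact ⟨ht₂, ht₀⟩)
  rw [Fin.forall_fin_two, prinEdge_two_zero, prinEdge_two_one] at hr
  change (X.δ 2).app _ r = α ∧ (X.δ 0).app _ r = β at hr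
  refine ⟨(X.δ 1).app _ r, ?_, ?_, ?_, ?_⟩
  · rw [← hr.1]
    exact (map_app_map_app X rfl r).trans (map_app_map_app X
      (SimplexCategory.δ_comp_δ (i := (1 : Fin 2)) (j := 1) le_rfl) r).symm
  · rw [← hr.2]
    exact (map_app_map_app X rfl r).trans (map_app_map_app X
      (SimplexCategory.δ_comp_δ (i := (0 : Fin 2)) (j := 0) le_rfl).symm r).symm
  · rw [← r1, app_δ]
  · rw [← r0, app_δ]

/-- A square of a Segal space gives a commutative square in its homotopy category. Both composites
represent the transport of the source of the square along the constant path and its right side. -/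
lemma mk_comp_ver {x y x' y' : Ho X} (α : (X _⦋1⦌) _⦋1⦌) {f f' : (X _⦋1⦌) _⦋0⦌}
    {a b : (X _⦋0⦌) _⦋1⦌} (hf : (X _⦋1⦌).δ 1 α = f) (hf' : (X _⦋1⦌).δ 0 α = f')
    (ha : (X.δ 1).app _ α = a) (hb : (X.δ 0).app _ α = b)
    (hf₁ : (X.δ 1).app _ f = x) (hf₀ : (X.δ 0).app _ f = y)
    (hf'₁ : (X.δ 1).app _ f' = x') (hf'₀ : (X.δ 0).app _ f' = y')
    (ha₁ : (X _⦋0⦌).δ 1 a = x) (ha₀ : (X _⦋0⦌).δ 0 a = x')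
    (hb₁ : (X _⦋0⦌).δ 1 b = y) (hb₀ : (X _⦋0⦌).δ 0 b = y') :
    mk f hf₁ hf₀ ≫ ver b hb₁ hb₀ = ver a ha₁ ha₀ ≫ mk f' hf'₁ hf'₀ := by
  obtain ⟨p, ⟨p1, p0, ps⟩, pt1, pt0⟩ := exists_ver a ha₁ ha₀
  obtain ⟨q, ⟨q1, q0, qs⟩, qt1, qt0⟩ := exists_ver b hb₁ hb₀
  rw [ver_eq ha₁ ha₀ p p1 p0 ps rfl pt1 pt0, ver_eq hb₁ hb₀ q q1 q0 qs rfl qt1 qt0]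
  obtain ⟨s, s2, s0⟩ := exists_triangle X f ((X _⦋1⦌).δ 0 q) (hf₀.trans qt1.symm)
  obtain ⟨t, t2, t0⟩ := exists_triangle X ((X _⦋1⦌).δ 0 p) f' (pt0.trans hf'₁.symm)
  -- Horizontal simplicial identities are simplicial identities in a row.
  let R : SSet.{u} := X.flip.obj (op ⦋0⦌)
  -- `γ` is the constant square on `f` followed by the square defining `ver b`, and `γ'` is the
  -- square defining `ver a` followed by `α`; both start at `f` and lie over the constant path at
  -- `x` and `b`.
  obtain ⟨γ, γ1, γ0, γs, γt⟩ := exists_comp_square ((X _⦋1⦌).σ 0 f) q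
    (by rw [app_σ, hf₀, q1]) ((X.σ 1).app _ f) s ((δ_succ_σ R f 1).trans (δ_σ_vertex _ _ _).symm)
    ((δ_zero_σ_one R f).trans ((congrArg (R.σ 0) hf₀).trans qs.symm))
    (s2.trans (δ_σ_vertex _ _ _).symm) s0
  obtain ⟨γ', γ'1, γ'0, γ's, γ't⟩ := exists_comp_square p α (p0.trans ha.symm) ((X.σ 0).app _ f) t
    ((δ_two_σ_zero R f).trans ((congrArg (R.σ 0) hf₁).trans ps.symm))
    ((δ_castSucc_σ R f 0).trans hf.symm) t2 (t0.trans hf'.symm)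
  have k1 : (X.δ 1).app _ ((X _⦋1⦌).δ 0 γ) = x := by
    rw [app_δ, γ1, ← app_δ, δ_σ_vertex, hf₁]
  have k0 : (X.δ 0).app _ ((X _⦋1⦌).δ 0 γ) = y' := by
    rw [app_δ, γ0, ← app_δ, qt0]
  have k'1 : (X.δ 1).app _ ((X _⦋1⦌).δ 0 γ') = x := by
    rw [app_δ, γ'1, ← app_δ, pt1]
  have k'0 : (X.δ 0).app _ ((X _⦋1⦌).δ 0 γ') = y' := by
    rw [app_δ, γ'0, ← app_δ, hf', hf'₀]
  rw [mk_comp_mk s s2 s0 γt.symm _ _ _ _ k1 k0, mk_comp_mk t t2 t0 γ't.symm _ _ _ _ k'1 k'0]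
  refine mk_target_eq γ γ' ?_ ?_ ?_ rfl rfl _ _ _ _
  · rw [γs, γ's]
    exact (δ_castSucc_σ R f 1).trans (δ_succ_σ R f 0).symm
  · rw [γ1, γ'1, app_σ, hf₁, p1]
  · rw [γ0, γ'0, q0, hb]

lemma ver_σ {x : Ho X} {e : (X _⦋0⦌) _⦋1⦌} (he : e = (X _⦋0⦌).σ 0 x) (h₁ : (X _⦋0⦌).δ 1 e = x)
    (h₀ : (X _⦋0⦌).δ 0 e = x) : ver e h₁ h₀ = 𝟙 x := by
  subst he
  rw [← mk_σ (δ_app_σ_app X x 1) (δ_app_σ_app X x 0)]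
  refine ver_eq _ _ ((X _⦋1⦌).σ 0 ((X.σ 0).app _ x)) ?_ ?_ (δ_σ_vertex _ _ _)
    (δ_σ_vertex _ _ _) _ _
  · rw [app_σ]
    exact congrArg _ (δ_app_σ_app X x 1)
  · rw [app_σ]
    exact congrArg _ (δ_app_σ_app X x 0)

lemma ver_comp_ver {x y z : Ho X} (t : (X _⦋0⦌) _⦋2⦌) {a b c : (X _⦋0⦌) _⦋1⦌}
    (ha : (X _⦋0⦌).δ 2 t = a) (hb : (X _⦋0⦌).δ 0 t = b) (hc : (X _⦋0⦌).δ 1 t = c)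
    (ha₁ : (X _⦋0⦌).δ 1 a = x) (ha₀ : (X _⦋0⦌).δ 0 a = y)
    (hb₁ : (X _⦋0⦌).δ 1 b = y) (hb₀ : (X _⦋0⦌).δ 0 b = z)
    (hc₁ : (X _⦋0⦌).δ 1 c = x) (hc₀ : (X _⦋0⦌).δ 0 c = z) :
    ver a ha₁ ha₀ ≫ ver b hb₁ hb₀ = ver c hc₁ hc₀ := by
  obtain ⟨p, ⟨p1, p0, ps⟩, pt1, pt0⟩ := exists_ver a ha₁ ha₀
  obtain ⟨q, ⟨q1, q0, qs⟩, qt1, qt0⟩ := exists_ver c hc₁ hc₀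
  rw [ver_eq ha₁ ha₀ p p1 p0 ps rfl pt1 pt0, ver_eq hc₁ hc₀ q q1 q0 qs rfl qt1 qt0]
  have key (i : Fin 3) : (X _⦋0⦌).δ i ((X _⦋0⦌).map (SimplexCategory.const ⦋2⦌ ⦋0⦌ 0).op x) =
      (X _⦋0⦌).σ 0 x := map_map_of_comp _ (Subsingleton.elim _ _) _
  -- The squares defining `ver a` and `ver c` both start at the identity of `x`; the square
  -- relation is applied to the square between their targets lying over the constant path at `x`
  -- and `b`.
  obtain ⟨γ, γ1, γ0, γs, γt⟩ := exists_square_of_horn X p q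
    ((X _⦋0⦌).map (SimplexCategory.const ⦋2⦌ ⦋0⦌ 0).op x) t (ps.trans qs.symm)
    (p1.trans (key _).symm) (p0.trans ha.symm) (q1.trans (key _).symm) (q0.trans hc.symm)
  rw [mk_comp_ver γ γs γt (γ1.trans (key _)) (γ0.trans hb) _ _ qt1 qt0 (δ_σ_vertex _ _ _)
    (δ_σ_vertex _ _ _) hb₁ hb₀,
    ver_σ rfl, Category.id_comp]

/-- The inverse of the morphism associated to a path `e` from `x` to `y` is represented by the
target of a lift, starting at the identity of `x`, of the pair formed by `e` and the constant path
at `x`. -/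
instance isIso_ver {x y : Ho X} (e : (X _⦋0⦌) _⦋1⦌) (h₁ : (X _⦋0⦌).δ 1 e = x)
    (h₀ : (X _⦋0⦌).δ 0 e = y) : IsIso (ver e h₁ h₀) := by
  obtain ⟨β, β1, β0, βs⟩ := exists_square_of_source X ((X.σ 0).app _ x) e ((X _⦋0⦌).σ 0 x)
    (h₁.trans (δ_app_σ_app X _ _).symm) ((δ_σ_vertex _ _ _).trans (δ_app_σ_app X _ _).symm)
  have u1 : (X.δ 1).app _ ((X _⦋1⦌).δ 0 β) = y := by rw [app_δ, β1, h₀]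
  have u0 : (X.δ 0).app _ ((X _⦋1⦌).δ 0 β) = x := by 
    rw [app_δ, β0]
    exact δ_σ_vertex _ _ _
  -- `γ` goes from the target of `β` to the identity of `y`, over the constant path at `y` and `e`.
  obtain ⟨γ, γ1, γ0, γs, γt⟩ := exists_square_of_horn X β ((X.σ 0).app _ e) ((X _⦋0⦌).σ 1 e)
    ((X _⦋0⦌).σ 0 e) (by rw [βs, ← app_δ, h₁])
    (β1.trans (δ_succ_σ _ _ 1).symm) (by rw [β0, δ_two_σ_zero, h₁])
    ((δ_app_σ_app X _ _).trans (δ_castSucc_σ _ _ 1).symm)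
    ((δ_app_σ_app X _ _).trans (δ_succ_σ _ _ 0).symm)
  rw [← app_δ, h₀] at γt
  rw [δ_zero_σ_one, h₀] at γ1
  replace γ0 := γ0.trans (δ_castSucc_σ _ _ 0)
  refine ⟨mk _ u1 u0, ?_, ?_⟩
  · have := mk_comp_ver β βs rfl β1 β0 (δ_app_σ_app X _ _) (δ_app_σ_app X _ _) u1 u0
      h₁ h₀ (δ_σ_vertex _ _ _) (δ_σ_vertex _ _ _)
    rw [← this, mk_σ, ver_σ rfl, Category.id_comp]
  · have := mk_comp_ver γ γs γt γ1 γ0 u1 u0 (δ_app_σ_app X _ _) (δ_app_σ_app X _ _)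
      (δ_σ_vertex _ _ _) (δ_σ_vertex _ _ _) h₁ h₀
    rw [this, mk_σ, ver_σ rfl, Category.id_comp]

end Ho

/-! ### Functors out of `J × FreeGroupoid D` -/

section

universe v₁ u₁ v₂ u₂ v₃ u₃

variable {D : Type u₁} [Category.{v₁} D] {E : Type u₂} [Category.{v₂} E]
  {J : Type u₃} [Category.{v₃} J]

/-- The functor `FreeGroupoid D ⥤ E` extending a functor `D ⥤ E` which inverts all morphisms. -/
noncomputable def freeGroupoidLift (K : D ⥤ E) (hK : ∀ ⦃d d' : D⦄ (g : d ⟶ d'), IsIso (K.map g)) :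
    FreeGroupoid D ⥤ E :=
  FreeGroupoid.lift (G := Core E)
    { obj d := ⟨K.obj d⟩
      map g := ⟨@asIso _ _ _ _ (K.map g) (hK g)⟩ } ⋙ Core.inclusion E

lemma freeGroupoidLift_map_homMk (K : D ⥤ E) (hK : ∀ ⦃d d' : D⦄ (g : d ⟶ d'), IsIso (K.map g))
    {d d' : D} (g : d ⟶ d') : (freeGroupoidLift K hK).map (FreeGroupoid.homMk g) = K.map g := by
  unfold freeGroupoidLift
  rw [Functor.comp_map, FreeGroupoid.lift_map_homMk]
  rfl

/-- Functors out of a free groupoid into an arbitrary category are determined by their restriction,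
since they factor through the core of the target. -/
lemma freeGroupoid_functor_ext {F G : FreeGroupoid D ⥤ E}
    (h : FreeGroupoid.of D ⋙ F = FreeGroupoid.of D ⋙ G) : F = G := by
  have hobj (d : D) : (FreeGroupoid.of D ⋙ Core.functorToCore F).obj d =
      (FreeGroupoid.of D ⋙ Core.functorToCore G).obj d := congrArg Core.mk (Functor.congr_obj h d)
  have key : FreeGroupoid.of D ⋙ Core.functorToCore F =
      FreeGroupoid.of D ⋙ Core.functorToCore G := by
    refine CategoryTheory.Functor.ext hobj ?_
    intro d d' g
    have := Functor.congr_hom h g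
    apply (Core.inclusion E).map_injective
    rw [Functor.map_comp, Functor.map_comp, eqToHom_map, eqToHom_map]
    exact this
  have := (FreeGroupoid.lift_unique _ _ key).trans (FreeGroupoid.lift_unique _ _ rfl).symm
  exact congrArg (· ⋙ Core.inclusion E) this

/-- A functor out of `J × FreeGroupoid D` is determined by its objects, the images of the
morphisms of `J` and the images of the morphisms of `D`. -/
lemma prod_freeGroupoid_functor_ext {F G : J × FreeGroupoid D ⥤ E}
    (hobj : ∀ (i : J) (d : D), F.obj (i, .mk d) = G.obj (i, .mk d))
    (hhor : ∀ ⦃i i' : J⦄ (f : i ⟶ i') (d : D),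
      F.map (Prod.mkHom f (𝟙 (FreeGroupoid.mk d))) =
        eqToHom (hobj i d) ≫ G.map (Prod.mkHom f (𝟙 (FreeGroupoid.mk d))) ≫
          eqToHom (hobj i' d).symm)
    (hver : ∀ (i : J) ⦃d d' : D⦄ (g : d ⟶ d'),
      F.map (Prod.mkHom (𝟙 i) (FreeGroupoid.homMk g)) =
        eqToHom (hobj i d) ≫ G.map (Prod.mkHom (𝟙 i) (FreeGroupoid.homMk g)) ≫
          eqToHom (hobj i d').symm) : F = G := by
  have key (i : J) : Prod.sectR i (FreeGroupoid D) ⋙ F = Prod.sectR i (FreeGroupoid D) ⋙ G :=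
    freeGroupoid_functor_ext (CategoryTheory.Functor.ext (hobj i) (fun d d' g => hver i g))
  have hobj' (p : J × FreeGroupoid D) : F.obj p = G.obj p := by
    obtain ⟨i, d⟩ := p
    obtain ⟨d, rfl⟩ := FreeGroupoid.of_obj_bijective.surjective d
    exact hobj i d
  refine CategoryTheory.Functor.ext hobj' ?_
  rintro ⟨i, d⟩ ⟨i', d'⟩ ⟨f, g⟩
  obtain ⟨d, rfl⟩ := FreeGroupoid.of_obj_bijective.surjective d
  obtain ⟨d', rfl⟩ := FreeGroupoid.of_obj_bijective.surjective d'
  change FreeGroupoid.mk d ⟶ FreeGroupoid.mk d' at g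
  have hg : F.map (Prod.mkHom (𝟙 i') g) = eqToHom (hobj i' d) ≫ G.map (Prod.mkHom (𝟙 i') g) ≫
      eqToHom (hobj i' d').symm := Functor.congr_hom (key i') g
  change i ⟶ i' at f
  change F.map (Prod.mkHom f g) = eqToHom (hobj i d) ≫ G.map (Prod.mkHom f g) ≫
    eqToHom (hobj i' d').symm
  have dec : Prod.mkHom f g = Prod.mkHom f (𝟙 (FreeGroupoid.mk d)) ≫ Prod.mkHom (𝟙 i') g := by
    ext <;> simp
  have e1 := congrArg F.map dec
  have e2 := congrArg G.map dec
  rw [Functor.map_comp] at e1 e2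
  refine e1.trans ?_
  rw [e2, hg, hhor f d]
  simp only [Category.assoc, eqToHom_trans_assoc, eqToHom_refl, Category.id_comp]

end

/-! ### Restriction of elements of bisimplicial sets -/

/-- The action of a pair of simplicial operators on an element of a bisimplicial set. -/
def restr {X : SSSet.{u}} {n n' m m' : SimplexCategory} (θ : n ⟶ n') (φ : m ⟶ m')
    (s : (X.obj (op n')).obj (op m')) : (X.obj (op n)).obj (op m) :=
  (X.map θ.op).app _ ((X.obj (op n')).map φ.op s)

section

variable {X : SSSet.{u}} {n n' n'' m m' m'' : SimplexCategory}

lemma map_app_restr {θ : n ⟶ n'} {θ' : n' ⟶ n''} {ψ : n ⟶ n''} (h : θ ≫ θ' = ψ)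
    (φ : m ⟶ m') (s : (X.obj (op n'')).obj (op m')) :
    (X.map θ.op).app _ (restr θ' φ s) = restr ψ φ s :=
  map_app_map_app X h _

lemma map_restr (θ : n ⟶ n') {φ : m ⟶ m'} {φ' : m' ⟶ m''} {ψ : m ⟶ m''} (h : φ ≫ φ' = ψ)
    (s : (X.obj (op n')).obj (op m'')) :
    (X.obj (op n)).map φ.op (restr θ φ' s) = restr θ ψ s := by
  rw [restr, ← NatTrans.naturality_apply, map_map_of_comp _ h]
  rfl

lemma restr_restr {θ : n ⟶ n'} {θ' : n' ⟶ n''} {ψ : n ⟶ n''} (h : θ ≫ θ' = ψ)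
    {φ : m ⟶ m'} {φ' : m' ⟶ m''} {χ : m ⟶ m''} (h' : φ ≫ φ' = χ)
    (s : (X.obj (op n'')).obj (op m'')) : restr θ φ (restr θ' φ' s) = restr ψ χ s := by
  rw [restr, map_restr _ h', map_app_restr h]

lemma restr_eq_map_app {θ θ' : n ⟶ n'} (h : θ = θ') {φ : m ⟶ m} (h' : φ = 𝟙 m)
    (s : (X.obj (op n')).obj (op m)) : restr θ φ s = (X.map θ'.op).app _ s := by
  rw [restr, map_of_eq_id _ h', h]

lemma restr_eq_map {θ : n ⟶ n} (h : θ = 𝟙 n) {φ φ' : m ⟶ m'} (h' : φ = φ')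
    (s : (X.obj (op n)).obj (op m')) : restr θ φ s = (X.obj (op n)).map φ'.op s := by
  rw [restr, map_app_id X h, h']

end

/-- The operator `[1] ⟶ [n]` with values `i ≤ j`. -/
def edgeOp {n : SimplexCategory} {i j : Fin (n.len + 1)} (h : i ≤ j) : ⦋1⦌ ⟶ n :=
  SimplexCategory.mkOfLe (n := n.len) i j h

lemma edgeOp_comp {n n' : SimplexCategory} {i j : Fin (n.len + 1)} (h : i ≤ j) (θ : n ⟶ n') :
    edgeOp h ≫ θ = edgeOp (θ.toOrderHom.monotone h) :=
  SimplexCategory.Hom.ext_one_left _ _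

lemma δ_one_edgeOp {n : SimplexCategory} {i j : Fin (n.len + 1)} (h : i ≤ j) :
    SimplexCategory.δ 1 ≫ edgeOp h = SimplexCategory.const ⦋0⦌ n i := by
  ext k; fin_cases k; rfl

lemma δ_zero_edgeOp {n : SimplexCategory} {i j : Fin (n.len + 1)} (h : i ≤ j) :
    SimplexCategory.δ 0 ≫ edgeOp h = SimplexCategory.const ⦋0⦌ n j := by
  ext k; fin_cases k; rfl

lemma σ_const {n : SimplexCategory} (i : Fin (n.len + 1)) :
    SimplexCategory.σ 0 ≫ SimplexCategory.const ⦋0⦌ n i = edgeOp (le_refl i) :=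
  SimplexCategory.Hom.ext_one_left _ _

/-- The operator `[2] ⟶ [n]` with values `i ≤ j ≤ k`. -/
def triangleOp {n : SimplexCategory} {i j k : Fin (n.len + 1)} (h : i ≤ j) (h' : j ≤ k) : ⦋2⦌ ⟶ n :=
  SimplexCategory.mkOfLeComp (n := n.len) i j k h h'

section

variable {n : SimplexCategory} {i j k : Fin (n.len + 1)} (h : i ≤ j) (h' : j ≤ k)

lemma δ_two_triangleOp : SimplexCategory.δ 2 ≫ triangleOp h h' = edgeOp h :=
  SimplexCategory.Hom.ext_one_left _ _

lemma δ_zero_triangleOp : SimplexCategory.δ 0 ≫ triangleOp h h' = edgeOp h' :=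
  SimplexCategory.Hom.ext_one_left _ _

lemma δ_one_triangleOp : SimplexCategory.δ 1 ≫ triangleOp h h' = edgeOp (h.trans h') :=
  SimplexCategory.Hom.ext_one_left _ _

end

namespace Ho

/-! ### The unit `X ⟶ N (Ho X)` -/

section

variable {X : SSSet.{u}} {n m : SimplexCategory} (s : (X.obj (op n)).obj (op m))

/-- The `(i, j)`-th vertex of an element of a bisimplicial set. -/
def vertex (i : Fin (n.len + 1)) (j : Fin (m.len + 1)) : Ho X :=
  restr (SimplexCategory.const ⦋0⦌ n i) (SimplexCategory.const ⦋0⦌ m j) s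

lemma vertex_restr {n' m' : SimplexCategory} (θ : n' ⟶ n) (φ : m' ⟶ m)
    (i : Fin (n'.len + 1)) (j : Fin (m'.len + 1)) :
    vertex (restr θ φ s) i j = vertex s (θ.toOrderHom i) (φ.toOrderHom j) :=
  restr_restr (SimplexCategory.const_comp _ _ _) (SimplexCategory.const_comp _ _ _) s

lemma vertex_of_hor_zero {i i' : Fin (n.len + 1)} (h : i ≤ i') (j : Fin (m.len + 1)) {x : Ho X}
    {f : (X _⦋1⦌) _⦋0⦌} (hf : restr (edgeOp h) (SimplexCategory.const ⦋0⦌ m j) s = f)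
    (h₁ : (X.δ 1).app _ f = x) : vertex s i j = x :=
  (map_app_restr (δ_one_edgeOp h) _ s).symm.trans ((congrArg _ hf).trans h₁)

lemma vertex_of_hor_one {i i' : Fin (n.len + 1)} (h : i ≤ i') (j : Fin (m.len + 1)) {x : Ho X}
    {f : (X _⦋1⦌) _⦋0⦌} (hf : restr (edgeOp h) (SimplexCategory.const ⦋0⦌ m j) s = f)
    (h₀ : (X.δ 0).app _ f = x) : vertex s i' j = x :=
  (map_app_restr (δ_zero_edgeOp h) _ s).symm.trans ((congrArg _ hf).trans h₀)

lemma vertex_of_vert_zero (i : Fin (n.len + 1)) {j j' : Fin (m.len + 1)} (h : j ≤ j') {x : Ho X}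
    {e : (X _⦋0⦌) _⦋1⦌} (he : restr (SimplexCategory.const ⦋0⦌ n i) (edgeOp h) s = e)
    (h₁ : (X _⦋0⦌).δ 1 e = x) : vertex s i j = x :=
  (map_restr _ (δ_one_edgeOp h) s).symm.trans ((congrArg _ he).trans h₁)

lemma vertex_of_vert_one (i : Fin (n.len + 1)) {j j' : Fin (m.len + 1)} (h : j ≤ j') {x : Ho X}
    {e : (X _⦋0⦌) _⦋1⦌} (he : restr (SimplexCategory.const ⦋0⦌ n i) (edgeOp h) s = e)
    (h₀ : (X _⦋0⦌).δ 0 e = x) : vertex s i j' = x :=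
  (map_restr _ (δ_zero_edgeOp h) s).symm.trans ((congrArg _ he).trans h₀)

variable [IsSegalSpace X]

/-- The morphism of the homotopy category given by a horizontal edge of `s`. -/
def hor {i i' : Fin (n.len + 1)} (h : i ≤ i') (j : Fin (m.len + 1)) :
    vertex s i j ⟶ vertex s i' j :=
  mk (restr (edgeOp h) (SimplexCategory.const ⦋0⦌ m j) s)
    (map_app_restr (δ_one_edgeOp h) _ s) (map_app_restr (δ_zero_edgeOp h) _ s)

/-- The morphism of the homotopy category given by a vertical edge of `s`. -/
noncomputable def vert (i : Fin (n.len + 1)) {j j' : Fin (m.len + 1)} (h : j ≤ j') :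
    vertex s i j ⟶ vertex s i j' :=
  ver (restr (SimplexCategory.const ⦋0⦌ n i) (edgeOp h) s)
    (map_restr _ (δ_one_edgeOp h) s) (map_restr _ (δ_zero_edgeOp h) s)

lemma hor_refl (i : Fin (n.len + 1)) (j : Fin (m.len + 1)) : hor s (le_refl i) j = 𝟙 _ := by
  have h : (X.σ 0).app _ (vertex s i j) =
      restr (edgeOp (le_refl i)) (SimplexCategory.const ⦋0⦌ m j) s :=
    map_app_restr (σ_const i) _ s
  change _ = mk ((X.σ 0).app _ (vertex s i j)) (δ_app_σ_app X _ 1) (δ_app_σ_app X _ 0)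
  unfold hor
  congr 1
  exact h.symm

lemma hor_trans {i j k : Fin (n.len + 1)} (h : i ≤ j) (h' : j ≤ k) (l : Fin (m.len + 1)) :
    hor s (h.trans h') l = hor s h l ≫ hor s h' l :=
  (mk_comp_mk (restr (triangleOp h h') _ s) (map_app_restr (δ_two_triangleOp h h') _ s)
    (map_app_restr (δ_zero_triangleOp h h') _ s) (map_app_restr (δ_one_triangleOp h h') _ s)
    _ _ _ _ _ _).symm

lemma vert_refl (i : Fin (n.len + 1)) (j : Fin (m.len + 1)) : vert s i (le_refl j) = 𝟙 _ :=
  ver_σ (map_restr _ (σ_const j) s).symm _ _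

lemma vert_trans (l : Fin (n.len + 1)) {i j k : Fin (m.len + 1)} (h : i ≤ j) (h' : j ≤ k) :
    vert s l (h.trans h') = vert s l h ≫ vert s l h' :=
  (ver_comp_ver (restr _ (triangleOp h h') s) (map_restr _ (δ_two_triangleOp h h') s)
    (map_restr _ (δ_zero_triangleOp h h') s) (map_restr _ (δ_one_triangleOp h h') s)
    _ _ _ _ _ _).symm

lemma hor_comp_vert {i i' : Fin (n.len + 1)} (h : i ≤ i') {j j' : Fin (m.len + 1)} (h' : j ≤ j') :
    hor s h j ≫ vert s i' h' = vert s i h' ≫ hor s h j' :=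
  mk_comp_ver (restr (edgeOp h) (edgeOp h') s)
    (map_restr _ (δ_one_edgeOp h') s) (map_restr _ (δ_zero_edgeOp h') s)
    (map_app_restr (δ_one_edgeOp h) _ s) (map_app_restr (δ_zero_edgeOp h) _ s)
    _ _ _ _ _ _ _ _

instance (i : Fin (n.len + 1)) {j j' : Fin (m.len + 1)} (h : j ≤ j') : IsIso (vert s i h) :=
  isIso_ver _ _ _

/-- The rows of `s`, as a functor `[m] ⥤ Fun([n], Ho X)`. -/
noncomputable def rows : Fin (m.len + 1) ⥤ Fin (n.len + 1) ⥤ Ho X where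
  obj j :=
    { obj i := vertex s i j
      map f := hor s (leOfHom f) j
      map_id i := hor_refl s i j
      map_comp f g := hor_trans s (leOfHom f) (leOfHom g) j }
  map g :=
    { app i := vert s i (leOfHom g)
      naturality _ _ f := hor_comp_vert s (leOfHom f) (leOfHom g) }
  map_id j := by
    ext i
    exact vert_refl s i j
  map_comp f g := by
    ext i
    exact vert_trans s i (leOfHom f) (leOfHom g)

lemma isIso_rows_map ⦃j j' : Fin (m.len + 1)⦄ (g : j ⟶ j') : IsIso ((rows s).map g) := by
  rw [NatTrans.isIso_iff_isIso_app]
  intro i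
  exact inferInstanceAs (IsIso (vert s i (leOfHom g)))

/-- The functor `[n] × I[m] ⥤ Ho X` given by an element of `X_{n,m}`. -/
noncomputable def grid : ClassifyingDiagram.Shape n m ⥤ Ho X :=
  CategoryTheory.Prod.swap _ _ ⋙ Functor.uncurry.obj (freeGroupoidLift (rows s) (isIso_rows_map s))

lemma grid_map_hor {i i' : Fin (n.len + 1)} (f : i ⟶ i') (j : Fin (m.len + 1)) :
    (grid s).map (Prod.mkHom f (𝟙 (FreeGroupoid.mk j))) = hor s (leOfHom f) j := by
  have h : ((freeGroupoidLift (rows s) (isIso_rows_map s)).map (𝟙 (FreeGroupoid.mk j))).app i =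
      𝟙 (vertex s i j) :=
    congrArg (fun t => NatTrans.app t i)
      ((freeGroupoidLift (rows s) (isIso_rows_map s)).map_id (FreeGroupoid.mk j))
  exact (congrArg (· ≫ hor s (leOfHom f) j) h).trans (Category.id_comp _)

lemma grid_map_vert (i : Fin (n.len + 1)) {j j' : Fin (m.len + 1)} (g : j ⟶ j') :
    (grid s).map (Prod.mkHom (𝟙 i) (FreeGroupoid.homMk g)) = vert s i (leOfHom g) := by
  have h : ((freeGroupoidLift (rows s) (isIso_rows_map s)).map (FreeGroupoid.homMk g)).app i =
      vert s i (leOfHom g) :=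
    congrArg (fun t => NatTrans.app t i) (freeGroupoidLift_map_homMk _ (isIso_rows_map s) g)
  exact (congrArg₂ (· ≫ ·) h (hor_refl s i j')).trans (Category.comp_id _)

lemma mk_eqToHom {x y x' y' : Ho X} {f f' : (X _⦋1⦌) _⦋0⦌} (h : f = f')
    (h₁ : (X.δ 1).app _ f = x) (h₀ : (X.δ 0).app _ f = y)
    (h'₁ : (X.δ 1).app _ f' = x') (h'₀ : (X.δ 0).app _ f' = y') (hx : x = x') (hy : y = y') :
    mk f h₁ h₀ = eqToHom hx ≫ mk f' h'₁ h'₀ ≫ eqToHom hy.symm := by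
  subst hx hy h
  simp

lemma ver_eqToHom {x y x' y' : Ho X} {e e' : (X _⦋0⦌) _⦋1⦌} (h : e = e')
    (h₁ : (X _⦋0⦌).δ 1 e = x) (h₀ : (X _⦋0⦌).δ 0 e = y)
    (h'₁ : (X _⦋0⦌).δ 1 e' = x') (h'₀ : (X _⦋0⦌).δ 0 e' = y') (hx : x = x') (hy : y = y') :
    ver e h₁ h₀ = eqToHom hx ≫ ver e' h'₁ h'₀ ≫ eqToHom hy.symm := by
  subst hx hy h
  simp

section

variable {n' m' : SimplexCategory} (θ : n' ⟶ n) (φ : m' ⟶ m)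

lemma hor_restr {i i' : Fin (n'.len + 1)} (h : i ≤ i') (j : Fin (m'.len + 1)) :
    hor (restr θ φ s) h j = eqToHom (vertex_restr s θ φ i j) ≫
      hor s (θ.toOrderHom.monotone h) (φ.toOrderHom j) ≫ eqToHom (vertex_restr s θ φ i' j).symm :=
  mk_eqToHom (restr_restr (edgeOp_comp _ _) (SimplexCategory.const_comp _ _ _) s) _ _ _ _
    (vertex_restr s θ φ i j) (vertex_restr s θ φ i' j)

lemma vert_restr (i : Fin (n'.len + 1)) {j j' : Fin (m'.len + 1)} (h : j ≤ j') :
    vert (restr θ φ s) i h = eqToHom (vertex_restr s θ φ i j) ≫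
      vert s (θ.toOrderHom i) (φ.toOrderHom.monotone h) ≫ eqToHom (vertex_restr s θ φ i j').symm :=
  ver_eqToHom (restr_restr (SimplexCategory.const_comp _ _ _) (edgeOp_comp _ _) s) _ _ _ _
    (vertex_restr s θ φ i j) (vertex_restr s θ φ i j')

lemma grid_restr : grid (restr θ φ s) = ClassifyingDiagram.Shape.map θ φ ⋙ grid s := by
  refine prod_freeGroupoid_functor_ext (vertex_restr s θ φ) ?_ ?_
  · intro i i' f j
    have e : (ClassifyingDiagram.Shape.map θ φ).map (Prod.mkHom f (𝟙 (FreeGroupoid.mk j))) =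
        Prod.mkHom (homOfLE (θ.toOrderHom.monotone (leOfHom f)))
          (𝟙 (FreeGroupoid.mk (φ.toOrderHom j))) :=
      Prod.ext rfl ((FreeGroupoid.map φ.toOrderHom.monotone.functor).map_id (FreeGroupoid.mk j))
    have e' := (congrArg (grid s).map e).trans (grid_map_hor s _ _)
    refine (grid_map_hor _ f j).trans ((hor_restr s θ φ (leOfHom f) j).trans ?_)
    exact congrArg (fun t => eqToHom (vertex_restr s θ φ i j) ≫ t ≫
      eqToHom (vertex_restr s θ φ i' j).symm) e'.symm
  · intro i j j' g
    have e : (ClassifyingDiagram.Shape.map θ φ).map (Prod.mkHom (𝟙 i) (FreeGroupoid.homMk g)) =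
        Prod.mkHom (𝟙 (θ.toOrderHom i))
          (FreeGroupoid.homMk (homOfLE (φ.toOrderHom.monotone (leOfHom g)))) :=
      Prod.ext rfl rfl
    have e' := (congrArg (grid s).map e).trans (grid_map_vert s _ _)
    refine (grid_map_vert _ i g).trans ((vert_restr s θ φ i (leOfHom g)).trans ?_)
    exact congrArg (fun t => eqToHom (vertex_restr s θ φ i j) ≫ t ≫
      eqToHom (vertex_restr s θ φ i j').symm) e'.symm

end

end

/-- The canonical morphism from a Segal space to the classifying diagram of its homotopy category,
sending an element of `X_{n,m}` to the grid of its edges. -/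
noncomputable def unit (X : SSSet.{u}) [IsSegalSpace X] : X ⟶ N.obj (Cat.of (Ho X)) where
  app n :=
    { app m := ↾fun s => grid (n := n.unop) (m := m.unop) s
      naturality m m' φ := by
        ext s
        have h := grid_restr (n := n.unop) (m := m.unop) s (𝟙 _) φ.unop
        have e : restr (𝟙 n.unop) φ.unop s = (X.obj n).map φ s := restr_eq_map rfl rfl s
        rw [e] at h
        exact h }
  naturality n n' θ := by
    ext m s
    have h := grid_restr (n := n.unop) (m := m.unop) s θ.unop (𝟙 _)
    have e : restr θ.unop (𝟙 m.unop) s = (X.map θ).app m s := restr_eq_map_app rfl rfl s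
    rw [e] at h
    exact h

end Ho

/-! ### Functors out of the homotopy category -/

namespace ClassifyingDiagram

/-- The morphism `(i, j) ⟶ (i', j)` of `[n] × I[m]`. -/
def Shape.hor {n m : SimplexCategory} {i i' : Fin (n.len + 1)} (h : i ≤ i') (j : Fin (m.len + 1)) :
    ((i, .mk j) : Shape n m) ⟶ (i', .mk j) :=
  Prod.mkHom (homOfLE h) (𝟙 (FreeGroupoid.mk j))

/-- The morphism `(i, j) ⟶ (i, j')` of `[n] × I[m]`. -/
def Shape.vert {n m : SimplexCategory} (i : Fin (n.len + 1)) {j j' : Fin (m.len + 1)} (h : j ≤ j') :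
    ((i, .mk j) : Shape n m) ⟶ (i, .mk j') :=
  Prod.mkHom (𝟙 i) (FreeGroupoid.homMk (homOfLE h))

section

variable {n m : SimplexCategory}

lemma Shape.vert_refl (i : Fin (n.len + 1)) (j : Fin (m.len + 1)) :
    Shape.vert i (le_refl j) = 𝟙 ((i, .mk j) : Shape n m) :=
  Prod.ext rfl ((FreeGroupoid.of _).map_id j)

lemma Shape.hor_comp_hor {i j k : Fin (n.len + 1)} (h : i ≤ j) (h' : j ≤ k) (l : Fin (m.len + 1)) :
    Shape.hor h l ≫ Shape.hor h' l = Shape.hor (h.trans h') l :=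
  Prod.ext rfl (Category.id_comp _)

lemma Shape.hor_comp_vert {i i' : Fin (n.len + 1)} (h : i ≤ i') {j j' : Fin (m.len + 1)}
    (h' : j ≤ j') :
    Shape.hor h j ≫ Shape.vert i' h' = Shape.vert i h' ≫ Shape.hor h j' :=
  Prod.ext rfl ((Category.id_comp _).trans (Category.comp_id _).symm)

end

end ClassifyingDiagram

namespace Ho

open ClassifyingDiagram

section

variable {X : SSSet.{u}} {C : Cat.{u, u}} (F : X ⟶ N.obj C)

/-- The functor `[n] × I[m] ⥤ C` associated by `F : X ⟶ N C` to an element of `X_{n,m}`. -/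
def eval {n m : SimplexCategory} (s : (X.obj (op n)).obj (op m)) : Shape n m ⥤ C :=
  (F.app (op n)).app (op m) s

lemma eval_restr {n n' m m' : SimplexCategory} (θ : n ⟶ n') (φ : m ⟶ m')
    (s : (X.obj (op n')).obj (op m')) : eval F (restr θ φ s) = Shape.map θ φ ⋙ eval F s := by
  have h₁ : (F.app (op n)).app (op m) (restr θ φ s) =
      Shape.map θ (𝟙 _) ⋙ eval F ((X.obj (op n')).map φ.op s) :=
    congrArg (fun t : X.obj (op n') ⟶ (N.obj C).obj (op n) =>
      t.app (op m) ((X.obj (op n')).map φ.op s)) (F.naturality θ.op)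
  have h₂ : eval F ((X.obj (op n')).map φ.op s) = Shape.map (𝟙 _) φ ⋙ eval F s :=
    NatTrans.naturality_apply (F.app (op n')) φ.op s
  refine h₁.trans ?_
  rw [h₂, ← Functor.assoc, ← Shape.map_comp, Category.comp_id, Category.id_comp]

/-- The object of `C` associated by `F : X ⟶ N C` to an object of the homotopy category. -/
def evalObj (x : Ho X) : C :=
  (eval F (n := ⦋0⦌) (m := ⦋0⦌) x).obj (0, .mk 0)

section

variable {n m : SimplexCategory} (s : (X.obj (op n)).obj (op m))

lemma eval_obj {i : Fin (n.len + 1)} {j : Fin (m.len + 1)} {x : Ho X} (h : vertex s i j = x) :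
    (eval F s).obj (i, .mk j) = evalObj F x := by
  subst h
  exact (Functor.congr_obj (eval_restr F (SimplexCategory.const ⦋0⦌ n i)
    (SimplexCategory.const ⦋0⦌ m j) s) (0, .mk 0)).symm

/-- The value of the functor `eval F s` on a morphism of `[n] × I[m]`, with source and target
expressed through the vertices of `s`. -/
def evalHom {i i' : Fin (n.len + 1)} {j j' : Fin (m.len + 1)}
    (g : ((i, .mk j) : Shape n m) ⟶ (i', .mk j')) {x y : Ho X} (hx : vertex s i j = x)
    (hy : vertex s i' j' = y) : evalObj F x ⟶ evalObj F y :=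
  eqToHom (eval_obj F s hx).symm ≫ (eval F s).map g ≫ eqToHom (eval_obj F s hy)

lemma evalHom_id {i : Fin (n.len + 1)} {j : Fin (m.len + 1)} {x : Ho X} (hx : vertex s i j = x) :
    evalHom F s (𝟙 ((i, .mk j) : Shape n m)) hx hx = 𝟙 _ := by
  simp [evalHom]

lemma evalHom_comp {i i' i'' : Fin (n.len + 1)} {j j' j'' : Fin (m.len + 1)}
    (g : ((i, .mk j) : Shape n m) ⟶ (i', .mk j')) (g' : ((i', .mk j') : Shape n m) ⟶ (i'', .mk j''))
    {x y z : Ho X} (hx : vertex s i j = x) (hy : vertex s i' j' = y) (hz : vertex s i'' j'' = z) :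
    evalHom F s g hx hy ≫ evalHom F s g' hy hz = evalHom F s (g ≫ g') hx hz := by
  simp only [evalHom, Category.assoc, eqToHom_trans_assoc, eqToHom_refl, Category.id_comp,
    Functor.map_comp]

variable {n' m' : SimplexCategory} {θ : n' ⟶ n} {φ : m' ⟶ m}

lemma evalHom_restr {i i' : Fin (n'.len + 1)} {j j' : Fin (m'.len + 1)}
    (g : ((i, .mk j) : Shape n' m') ⟶ (i', .mk j'))
    {s' : (X.obj (op n')).obj (op m')} (hs : restr θ φ s = s') {x y : Ho X}
    (hx : vertex s' i j = x) (hy : vertex s' i' j' = y)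
    (hx' : vertex s (θ.toOrderHom i) (φ.toOrderHom j) = x)
    (hy' : vertex s (θ.toOrderHom i') (φ.toOrderHom j') = y) :
    evalHom F s' g hx hy = evalHom F s ((Shape.map θ φ).map g) hx' hy' := by
  subst hs
  unfold evalHom
  rw [Functor.congr_hom (eval_restr F θ φ s) g]
  simp only [Category.assoc, eqToHom_trans_assoc, eqToHom_trans]
  rfl

lemma evalHom_restr_hor {i i' : Fin (n'.len + 1)} (h : i ≤ i') (j : Fin (m'.len + 1))
    {s' : (X.obj (op n')).obj (op m')} (hs : restr θ φ s = s') {x y : Ho X}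
    (hx : vertex s' i j = x) (hy : vertex s' i' j = y)
    (hx' : vertex s (θ.toOrderHom i) (φ.toOrderHom j) = x)
    (hy' : vertex s (θ.toOrderHom i') (φ.toOrderHom j) = y) :
    evalHom F s' (Shape.hor h j) hx hy =
      evalHom F s (Shape.hor (θ.toOrderHom.monotone h) (φ.toOrderHom j)) hx' hy' := by
  rw [evalHom_restr F s _ hs hx hy hx' hy']
  exact congrArg (fun t => evalHom F s t hx' hy') (Prod.ext rfl
    ((FreeGroupoid.map φ.toOrderHom.monotone.functor).map_id (FreeGroupoid.mk j)))

lemma evalHom_restr_vert (i : Fin (n'.len + 1)) {j j' : Fin (m'.len + 1)} (h : j ≤ j')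
    {s' : (X.obj (op n')).obj (op m')} (hs : restr θ φ s = s') {x y : Ho X}
    (hx : vertex s' i j = x) (hy : vertex s' i j' = y)
    (hx' : vertex s (θ.toOrderHom i) (φ.toOrderHom j) = x)
    (hy' : vertex s (θ.toOrderHom i) (φ.toOrderHom j') = y) :
    evalHom F s' (Shape.vert i h) hx hy =
      evalHom F s (Shape.vert (θ.toOrderHom i) (φ.toOrderHom.monotone h)) hx' hy' :=
  evalHom_restr F s _ hs hx hy hx' hy'

end

lemma restr_edgeOp_hor (f : (X _⦋1⦌) _⦋0⦌) :
    restr (edgeOp (n := ⦋1⦌) (i := 0) (j := 1) (Fin.zero_le _))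
      (SimplexCategory.const ⦋0⦌ ⦋0⦌ 0) f = f :=
  (restr_eq_map_app (SimplexCategory.Hom.ext_one_left _ (𝟙 ⦋1⦌)) (Subsingleton.elim _ _) f).trans
    (map_app_id X rfl f)

lemma restr_edgeOp_vert (e : (X _⦋0⦌) _⦋1⦌) :
    restr (SimplexCategory.const ⦋0⦌ ⦋0⦌ 0)
      (edgeOp (n := ⦋1⦌) (i := 0) (j := 1) (Fin.zero_le _)) e = e :=
  (restr_eq_map (Subsingleton.elim _ _) (SimplexCategory.Hom.ext_one_left _ (𝟙 ⦋1⦌)) e).trans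
    (map_of_eq_id _ rfl e)

/-- The morphism of `C` associated by `F : X ⟶ N C` to an element of `X_{1,0}`. -/
def evalHor {x y : Ho X} (f : (X _⦋1⦌) _⦋0⦌) (h₁ : (X.δ 1).app _ f = x)
    (h₀ : (X.δ 0).app _ f = y) : evalObj F x ⟶ evalObj F y :=
  evalHom F (n := ⦋1⦌) (m := ⦋0⦌) f (Shape.hor (n := ⦋1⦌) (i := 0) (i' := 1) (Fin.zero_le _) 0)
    (vertex_of_hor_zero f _ 0 (restr_edgeOp_hor f) h₁)
    (vertex_of_hor_one f _ 0 (restr_edgeOp_hor f) h₀)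

/-- The morphism of `C` associated by `F : X ⟶ N C` to a path in the space of objects of `X`. -/
def evalVert {x y : Ho X} (e : (X _⦋0⦌) _⦋1⦌) (h₁ : (X _⦋0⦌).δ 1 e = x)
    (h₀ : (X _⦋0⦌).δ 0 e = y) : evalObj F x ⟶ evalObj F y :=
  evalHom F (n := ⦋0⦌) (m := ⦋1⦌) e (Shape.vert (m := ⦋1⦌) 0 (j := 0) (j' := 1) (Fin.zero_le _))
    (vertex_of_vert_zero e 0 _ (restr_edgeOp_vert e) h₁)
    (vertex_of_vert_one e 0 _ (restr_edgeOp_vert e) h₀)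

section

variable {n m : SimplexCategory} (s : (X.obj (op n)).obj (op m))

lemma evalHor_restr {i i' : Fin (n.len + 1)} (h : i ≤ i') (j : Fin (m.len + 1)) {x y : Ho X}
    {f : (X _⦋1⦌) _⦋0⦌} (hf : restr (edgeOp h) (SimplexCategory.const ⦋0⦌ m j) s = f)
    (h₁ : (X.δ 1).app _ f = x) (h₀ : (X.δ 0).app _ f = y) :
    evalHor F f h₁ h₀ = evalHom F s (Shape.hor h j) (vertex_of_hor_zero s h j hf h₁)
      (vertex_of_hor_one s h j hf h₀) :=
  evalHom_restr_hor (θ := edgeOp h) F s (i := (0 : Fin 2)) (i' := (1 : Fin 2)) (Fin.zero_le _)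
    (0 : Fin 1) hf _ _ (vertex_of_hor_zero s h j hf h₁) (vertex_of_hor_one s h j hf h₀)

lemma evalVert_restr (i : Fin (n.len + 1)) {j j' : Fin (m.len + 1)} (h : j ≤ j') {x y : Ho X}
    {e : (X _⦋0⦌) _⦋1⦌} (he : restr (SimplexCategory.const ⦋0⦌ n i) (edgeOp h) s = e)
    (h₁ : (X _⦋0⦌).δ 1 e = x) (h₀ : (X _⦋0⦌).δ 0 e = y) :
    evalVert F e h₁ h₀ = evalHom F s (Shape.vert i h) (vertex_of_vert_zero s i h he h₁)
      (vertex_of_vert_one s i h he h₀) :=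
  evalHom_restr_vert (φ := edgeOp h) F s (0 : Fin 1) (j := (0 : Fin 2)) (j' := (1 : Fin 2))
    (Fin.zero_le _) he _ _ (vertex_of_vert_zero s i h he h₁) (vertex_of_vert_one s i h he h₀)

end

lemma evalHor_σ {x : Ho X} {f : (X _⦋1⦌) _⦋0⦌} (hf : (X.σ 0).app _ x = f)
    (h₁ : (X.δ 1).app _ f = x) (h₀ : (X.δ 0).app _ f = x) : evalHor F f h₁ h₀ = 𝟙 _ :=
  (evalHor_restr F (n := ⦋0⦌) (m := ⦋0⦌) x (le_refl 0) 0
    ((restr_eq_map_app (Subsingleton.elim _ _) (Subsingleton.elim _ _) x).trans hf) h₁ h₀).trans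
    (evalHom_id F _ _)

lemma evalVert_σ {x : Ho X} {e : (X _⦋0⦌) _⦋1⦌} (he : (X _⦋0⦌).σ 0 x = e)
    (h₁ : (X _⦋0⦌).δ 1 e = x) (h₀ : (X _⦋0⦌).δ 0 e = x) : evalVert F e h₁ h₀ = 𝟙 _ := by
  rw [evalVert_restr F (n := ⦋0⦌) (m := ⦋0⦌) x 0 (le_refl 0)
    ((restr_eq_map (Subsingleton.elim _ _) (Subsingleton.elim _ _) x).trans he) h₁ h₀,
    Shape.vert_refl]
  exact evalHom_id F _ _

lemma evalHor_comp {x y z : Ho X} {f g k : (X _⦋1⦌) _⦋0⦌} (s : (X _⦋2⦌) _⦋0⦌)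
    (h₂ : (X.δ 2).app _ s = f) (h₀ : (X.δ 0).app _ s = g) (h₁ : (X.δ 1).app _ s = k)
    (hf₁ : (X.δ 1).app _ f = x) (hf₀ : (X.δ 0).app _ f = y)
    (hg₁ : (X.δ 1).app _ g = y) (hg₀ : (X.δ 0).app _ g = z)
    (hk₁ : (X.δ 1).app _ k = x) (hk₀ : (X.δ 0).app _ k = z) :
    evalHor F f hf₁ hf₀ ≫ evalHor F g hg₁ hg₀ = evalHor F k hk₁ hk₀ := by
  have h01 : (0 : Fin 3) ≤ 1 := by decide
  have h12 : (1 : Fin 3) ≤ 2 := by decide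
  rw [evalHor_restr F (n := ⦋2⦌) (m := ⦋0⦌) s h01 0 ((restr_eq_map_app
      (SimplexCategory.Hom.ext_one_left _ _) (Subsingleton.elim _ _) s).trans h₂) hf₁ hf₀,
    evalHor_restr F (n := ⦋2⦌) (m := ⦋0⦌) s h12 0 ((restr_eq_map_app
      (SimplexCategory.Hom.ext_one_left _ _) (Subsingleton.elim _ _) s).trans h₀) hg₁ hg₀,
    evalHor_restr F (n := ⦋2⦌) (m := ⦋0⦌) s (h01.trans h12) 0 ((restr_eq_map_app
      (SimplexCategory.Hom.ext_one_left _ _) (Subsingleton.elim _ _) s).trans h₁) hk₁ hk₀,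
    evalHom_comp, Shape.hor_comp_hor]

lemma evalHor_comp_evalVert {x y x' y' : Ho X} (α : (X _⦋1⦌) _⦋1⦌) {f f' : (X _⦋1⦌) _⦋0⦌}
    {a b : (X _⦋0⦌) _⦋1⦌} (hf : (X _⦋1⦌).δ 1 α = f) (hf' : (X _⦋1⦌).δ 0 α = f')
    (ha : (X.δ 1).app _ α = a) (hb : (X.δ 0).app _ α = b)
    (hf₁ : (X.δ 1).app _ f = x) (hf₀ : (X.δ 0).app _ f = y)
    (hf'₁ : (X.δ 1).app _ f' = x') (hf'₀ : (X.δ 0).app _ f' = y')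
    (ha₁ : (X _⦋0⦌).δ 1 a = x) (ha₀ : (X _⦋0⦌).δ 0 a = x')
    (hb₁ : (X _⦋0⦌).δ 1 b = y) (hb₀ : (X _⦋0⦌).δ 0 b = y') :
    evalHor F f hf₁ hf₀ ≫ evalVert F b hb₁ hb₀ =
      evalVert F a ha₁ ha₀ ≫ evalHor F f' hf'₁ hf'₀ := by
  have h01 : (0 : Fin 2) ≤ 1 := by decide
  have e : edgeOp (n := ⦋1⦌) h01 = 𝟙 ⦋1⦌ := SimplexCategory.Hom.ext_one_left _ _
  rw [evalHor_restr F (n := ⦋1⦌) (m := ⦋1⦌) α h01 0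
      ((restr_eq_map e (const_δ 0) α).trans hf) hf₁ hf₀,
    evalHor_restr F (n := ⦋1⦌) (m := ⦋1⦌) α h01 1
      ((restr_eq_map e (const_δ 1) α).trans hf') hf'₁ hf'₀,
    evalVert_restr F (n := ⦋1⦌) (m := ⦋1⦌) α 0 h01
      ((restr_eq_map_app (const_δ 0) e α).trans ha) ha₁ ha₀,
    evalVert_restr F (n := ⦋1⦌) (m := ⦋1⦌) α 1 h01
      ((restr_eq_map_app (const_δ 1) e α).trans hb) hb₁ hb₀,
    evalHom_comp, evalHom_comp, Shape.hor_comp_vert]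

variable [IsSegalSpace X]

/-- The functor `Ho X ⥤ C` induced by `F : X ⟶ N C`. -/
noncomputable def desc : Ho X ⥤ C where
  obj := evalObj F
  map {x y} := π₀.lift (fun f => evalHor F f.1
    ((of_mem f.2).1.trans (map_const_zero (n := 0) x))
    ((of_mem f.2).2.trans (map_const_zero (n := 0) y))) (by
      intro f g a
      have hα : (X.δ 1).app _ a.edge.1 = (X _⦋0⦌).σ 0 x ∧
          (X.δ 0).app _ a.edge.1 = (X _⦋0⦌).σ 0 y := by
        have hσ : SimplexCategory.const ⦋1⦌ ⦋0⦌ 0 = SimplexCategory.σ 0 := Subsingleton.elim _ _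
        have h := of_mem a.edge.2
        rw [hσ] at h
        exact h
      have := evalHor_comp_evalVert F a.edge.1 (congrArg Subtype.val a.src_eq)
        (congrArg Subtype.val a.tgt_eq) hα.1 hα.2
        ((of_mem f.2).1.trans (map_const_zero (n := 0) x))
        ((of_mem f.2).2.trans (map_const_zero (n := 0) y))
        ((of_mem g.2).1.trans (map_const_zero (n := 0) x))
        ((of_mem g.2).2.trans (map_const_zero (n := 0) y))
        (δ_σ_vertex _ _ _) (δ_σ_vertex _ _ _) (δ_σ_vertex _ _ _) (δ_σ_vertex _ _ _)
      rwa [evalVert_σ F rfl, evalVert_σ F rfl, Category.id_comp, Category.comp_id] at this)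
  map_id x := evalHor_σ F rfl (δ_app_σ_app X _ _) (δ_app_σ_app X _ _)
  map_comp {x y z} f g := by
    obtain ⟨f, hf₁, hf₀, rfl⟩ := mk_surjective f
    obtain ⟨g, hg₁, hg₀, rfl⟩ := mk_surjective g
    obtain ⟨s, h₂, h₀⟩ := exists_triangle X f g (hf₀.trans hg₁.symm)
    have hk₁ : (X.δ 1).app _ ((X.δ 1).app _ s) = x := by
      rw [← hf₁, ← h₂]
      exact (map_app_map_app X rfl s).trans (map_app_map_app X
        (SimplexCategory.δ_comp_δ (i := (1 : Fin 2)) (j := 1) le_rfl) s).symm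
    have hk₀ : (X.δ 0).app _ ((X.δ 1).app _ s) = z := by
      rw [← hg₀, ← h₀]
      exact (map_app_map_app X rfl s).trans (map_app_map_app X
        (SimplexCategory.δ_comp_δ (i := (0 : Fin 2)) (j := 0) le_rfl).symm s).symm
    rw [mk_comp_mk s h₂ h₀ rfl hf₁ hf₀ hg₁ hg₀ hk₁ hk₀]
    exact (evalHor_comp F s h₂ h₀ rfl hf₁ hf₀ hg₁ hg₀ hk₁ hk₀).symm

lemma desc_map_mk {x y : Ho X} (f : (X _⦋1⦌) _⦋0⦌) (h₁ : (X.δ 1).app _ f = x)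
    (h₀ : (X.δ 0).app _ f = y) :
    ((desc F).map (mk f h₁ h₀) : evalObj F x ⟶ evalObj F y) = evalHor F f h₁ h₀ := rfl

/-- On the square defining `ver e`, whose source is an identity and whose left side is constant,
the value of `F` is a commutative square which identifies the images of `e` and of the target of
the square. -/
lemma desc_map_ver {x y : Ho X} (e : (X _⦋0⦌) _⦋1⦌) (h₁ : (X _⦋0⦌).δ 1 e = x)
    (h₀ : (X _⦋0⦌).δ 0 e = y) :
    ((desc F).map (ver e h₁ h₀) : evalObj F x ⟶ evalObj F y) = evalVert F e h₁ h₀ := by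
  obtain ⟨α, ⟨α1, α0, αs⟩, t1, t0⟩ := exists_ver e h₁ h₀
  rw [ver_eq h₁ h₀ α α1 α0 αs rfl t1 t0, desc_map_mk]
  have := evalHor_comp_evalVert F α αs rfl α1 α0 (δ_app_σ_app X _ _) (δ_app_σ_app X _ _) t1 t0
    (δ_σ_vertex _ _ _) (δ_σ_vertex _ _ _) h₁ h₀
  rw [evalHor_σ F rfl, evalVert_σ F rfl, Category.id_comp, Category.id_comp] at this
  exact this.symm

lemma unit_comp_map_desc : unit X ≫ N.map (desc F).toCatHom = F := by
  have key {n m : SimplexCategory} (s : (X.obj (op n)).obj (op m)) :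
      grid s ⋙ desc F = eval F s := by
    refine prod_freeGroupoid_functor_ext (fun i j => (eval_obj F s rfl).symm) ?_ ?_
    · intro i i' f j
      exact (congrArg (desc F).map (grid_map_hor s f j)).trans
        (evalHor_restr F s (leOfHom f) j rfl (map_app_restr (δ_one_edgeOp _) _ s)
          (map_app_restr (δ_zero_edgeOp _) _ s))
    · intro i j j' g
      exact (congrArg (desc F).map (grid_map_vert s i g)).trans
        ((desc_map_ver F _ (map_restr _ (δ_one_edgeOp _) s) (map_restr _ (δ_zero_edgeOp _) s)).trans
          (evalVert_restr F s i (leOfHom g) rfl _ _))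
  apply NatTrans.ext
  funext n
  apply NatTrans.ext
  funext m
  ext s
  exact key (n := n.unop) (m := m.unop) s

lemma desc_unit_comp (G : Cat.of (Ho X) ⟶ C) : desc (unit X ≫ N.map G) = G.toFunctor := by
  have hvertex (x : Ho X) : vertex (n := ⦋0⦌) (m := ⦋0⦌) x 0 0 = x :=
    (restr_eq_map_app (Subsingleton.elim _ (𝟙 _)) (Subsingleton.elim _ _) x).trans
      (map_app_id X rfl x)
  have hobj (x : Ho X) : (desc (unit X ≫ N.map G)).obj x = G.toFunctor.obj x :=
    congrArg G.toFunctor.obj (hvertex x)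
  refine CategoryTheory.Functor.ext hobj ?_
  intro x y g
  obtain ⟨f, h₁, h₀, rfl⟩ := mk_surjective g
  have hx : vertex (n := ⦋1⦌) (m := ⦋0⦌) f 0 0 = x :=
    vertex_of_hor_zero f _ 0 (restr_edgeOp_hor f) h₁
  have hy : vertex (n := ⦋1⦌) (m := ⦋0⦌) f 1 0 = y :=
    vertex_of_hor_one f _ 0 (restr_edgeOp_hor f) h₀
  have e : hor (n := ⦋1⦌) (m := ⦋0⦌) f (i := 0) (i' := 1) (Fin.zero_le _) 0 =
      eqToHom hx ≫ mk f h₁ h₀ ≫ eqToHom hy.symm :=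
    mk_eqToHom (restr_edgeOp_hor f) _ _ _ _ hx hy
  have e' (K : Ho X ⥤ C) :
      K.map (hor (n := ⦋1⦌) (m := ⦋0⦌) f (i := 0) (i' := 1) (Fin.zero_le _) 0) =
      eqToHom (congrArg K.obj hx) ≫ K.map (mk f h₁ h₀) ≫ eqToHom (congrArg K.obj hy.symm) := by
    rw [e, Functor.map_comp, Functor.map_comp, eqToHom_map, eqToHom_map]
  -- Stated separately since the objects in the goal match this pattern only up to unfolding.
  have cancel {a b c d : C} {a' d' : C} (p : a = b) (q : b = c) (g : c ⟶ d) (r : d = d')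
      (t : d' = a') :
      eqToHom p ≫ (eqToHom q ≫ g ≫ eqToHom r) ≫ eqToHom t =
        eqToHom (p.trans q) ≫ g ≫ eqToHom (r.trans t) := by
    simp
  refine (congrArg (fun t => eqToHom (eval_obj (unit X ≫ N.map G) f hx).symm ≫ t ≫
    eqToHom (eval_obj (unit X ≫ N.map G) f hy))
    ((congrArg G.toFunctor.map (grid_map_hor (n := ⦋1⦌) (m := ⦋0⦌) f
      (homOfLE (Fin.zero_le (1 : Fin 2))) 0)).trans (e' G.toFunctor))).trans ?_
  exact cancel _ _ _ _ _

end

/-- The universal property of the canonical morphism `X ⟶ N (Ho X)`. -/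
noncomputable def homEquiv (X : SSSet.{u}) [IsSegalSpace X] (C : Cat.{u, u}) :
    (X ⟶ N.obj C) ≃ (Cat.of (Ho X) ⟶ C) where
  toFun F := (desc F).toCatHom
  invFun G := unit X ≫ N.map G
  left_inv F := unit_comp_map_desc F
  right_inv G := congrArg Functor.toCatHom (desc_unit_comp G)

lemma homEquiv_naturality (X : SSSet.{u}) [IsSegalSpace X] {C D : Cat.{u, u}} (G : C ⟶ D)
    (F : X ⟶ N.obj C) : homEquiv X D (F ≫ N.map G) = homEquiv X C F ≫ G := by
  rw [← Equiv.eq_symm_apply]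
  change _ = unit X ≫ N.map (homEquiv X C F ≫ G)
  rw [N.map_comp, ← Category.assoc]
  exact congrArg (· ≫ N.map G) (unit_comp_map_desc F).symm

/-- The fundamental category and the homotopy category of a Segal space corepresent the same
functor. -/
noncomputable def isoτ₁ (X : SSSet.{u}) [IsSegalSpace X] : τ₁.obj X ≅ Cat.of (Ho X) :=
  (τ₁Adjunction.corepresentableBy X).uniqueUpToIso
    { homEquiv := (homEquiv X _).symm
      homEquiv_comp G H := by
        rw [Equiv.symm_apply_eq]
        exact ((homEquiv_naturality X G _).trans (by simp)).symm }

end Ho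

end SegalSpaces

theorem mainTheorem6 (X : SegalSpaces.SSSet.{u}) [SegalSpaces.IsSegalSpace X] :
    (∃ Φ : ∀ C : Cat.{u, u}, (X ⟶ SegalSpaces.N.obj C) ≃ (Cat.of (SegalSpaces.Ho X) ⟶ C),
      ∀ ⦃C D : Cat.{u, u}⦄ (G : C ⟶ D) (F : X ⟶ SegalSpaces.N.obj C),
        Φ D (F ≫ SegalSpaces.N.map G) = Φ C F ≫ G) ∧
    Nonempty (SegalSpaces.τ₁.obj X ≅ Cat.of (SegalSpaces.Ho X)) :=
  ⟨⟨SegalSpaces.Ho.homEquiv X, fun _ _ G F => SegalSpaces.Ho.homEquiv_naturality X G F⟩,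
    ⟨SegalSpaces.Ho.isoτ₁ X⟩⟩
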